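/- Let $\mathbb T^2=(\mathbb R/2\pi\mathbb Z)^2$, let $\hat f(k)=(2\pi)^{-2}\int_{\mathbb T^2}f(x)e^{-ik\cdot x}\,dx$ for $k\in\mathbb Z^2$, and let $H^r(\mathbb T^2)$ be the Sobolev space with norm $\|f\|_{H^r}=\big(\sum_{k\in\mathbb Z^2}(1+|k|^2)^r|\hat f(k)|^2\big)^{1/2}$. For $\nu\ge 0$ consider the incompressible porous media Brinkman (IPMB) equation $$\partial_t\theta^\nu+u^\nu\cdot\nabla\theta^\nu=0,\qquad u^\nu=M^\nu[\theta^\nu],\qquad \theta^\nu(\cdot,0)=\theta_0 \tag{1}$$ on $\mathbb T^2$, where $M^\nu$ is the Fourier multiplier with symbol $$\widehat{M}^\nu(k)=\frac{1}{1+\nu|k|^2}\Big(\frac{k_1k_2}{|k|^2},\,\frac{-k_1^2}{|k|^2}\Big)\quad(k\neq 0),\qquad \widehat M^\nu(0)=0 ;$$ for $\nu=0$ it is the incompressible porous media (IPM) equation. For $T>0$, an $H^s$ solution of (1) on $[0,T]$ is a real-valued $\theta\in C([0,T];L^2(\mathbb T^2))$ with $\theta(\cdot,0)=\theta_0$ and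 $\sup_{t\in[0,T]}\|\theta(\cdot,t)\|_{H^s}<\infty$ that solves (1) weakly: with $u=M^\nu[\theta]$, $$\int_0^T\!\!\int_{\mathbb T^2}(\partial_t\varphi+u\cdot\nabla\varphi)\,\theta\,dx\,dt+\int_{\mathbb T^2}\varphi(x,0)\,\theta_0(x)\,dx=0$$ for all smooth $\varphi$ on $\mathbb T^2\times[0,T)$ with compact support. **Theorem 6.11.** Let $s>2$, and let $\theta_0\in H^s(\mathbb T^2)$ be real-valued with zero mean. Let $T>0$, let $\theta^0$ be an $H^s$ solution of (1) with $\nu=0$ on $[0,T]$, and for each $\nu>0$ let $\theta^\nu$ be an $H^s$ solution of (1) on $[0,T]$ with the same initial datum $\theta_0$. Then for every $t\in[0,T]$, $$\lim_{\nu\to0^+}\|(\theta^\nu-\theta^0)(\cdot,t)\|_{H^{s-1}}=0 .$$ -/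

import Mathlib

namespace IPMB

open MeasureTheory Filter Topology Set
open scoped Real NNReal ENNReal

instance fact_two_pi_pos : Fact (0 < 2 * π) := ⟨Real.two_pi_pos⟩

/-- The torus `𝕋² = (ℝ / 2πℤ)²`. Its `volume` is the product Lebesgue measure, of total mass `(2π)²`. -/
abbrev Torus : Type := Fin 2 → AddCircle (2 * π)

/-- The projection `ℝ² → 𝕋²`. -/
noncomputable def proj (x : Fin 2 → ℝ) : Torus := fun j => (x j : AddCircle (2 * π))

/-- The character `x ↦ exp (i k · x)` of the torus. -/
noncomputable def mode (k : Fin 2 → ℤ) (x : Torus) : ℂ := ∏ j, fourier (k j) (x j)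

/-- The Fourier coefficient `f̂(k) = (2π)⁻² ∫ f(x) exp (-i k · x) dx`. -/
noncomputable def coeff (f : Torus → ℝ) (k : Fin 2 → ℤ) : ℂ :=
  (((2 * π) ^ 2 : ℝ) : ℂ)⁻¹ * ∫ x : Torus, (f x : ℂ) * mode (-k) x

/-- `|k|² = k₁² + k₂²`. -/
def normSq (k : Fin 2 → ℤ) : ℝ := (k 0 : ℝ) ^ 2 + (k 1 : ℝ) ^ 2

/-- The inhomogeneous Sobolev norm `‖f‖_{H^s} = (∑ₖ (1 + |k|²)^s |f̂(k)|²)^{1/2}`, with values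
in `[0, ∞]`. -/
noncomputable def sobolevNorm (s : ℝ) (f : Torus → ℝ) : ℝ≥0∞ :=
  (∑' k : Fin 2 → ℤ, ENNReal.ofReal ((1 + normSq k) ^ s * ‖coeff f k‖ ^ 2)) ^ (1 / 2 : ℝ)

/-- `f ∈ H^s(𝕋²)`, for `s ≥ 0`. -/
def MemSobolev (s : ℝ) (f : Torus → ℝ) : Prop :=
  MemLp f 2 volume ∧ sobolevNorm s f < ⊤

/-- The Fourier symbol of the constitutive law `u = (1 - νΔ)⁻¹ R^⊥ R₁ θ`, that is
`(1 + ν|k|²)⁻¹ (k₁k₂ / |k|², -k₁² / |k|²)`. It takes the value `0` at `k = 0`, a frequency that is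
absent from functions of zero mean. -/
noncomputable def symbol (ν : ℝ) (k : Fin 2 → ℤ) : Fin 2 → ℝ :=
  ![1 / (1 + ν * normSq k) * ((k 0 : ℝ) * (k 1 : ℝ) / normSq k),
    1 / (1 + ν * normSq k) * (-(k 0 : ℝ) ^ 2 / normSq k)]

/-- The velocity field `u = M^ν[f]`, given by its Fourier series. The series converges absolutely
for `f ∈ H^s`, `s > 1`, and its sum is real because `f` is real and the symbol is real and even. -/
noncomputable def velocity (ν : ℝ) (f : Torus → ℝ) (x : Torus) (j : Fin 2) : ℝ :=
  (∑' k : Fin 2 → ℤ, (symbol ν k j : ℂ) * coeff f k * mode k x).re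

/-- The partial derivative `∂g/∂x_j` on the torus. -/
noncomputable def partialDeriv (j : Fin 2) (g : Torus → ℝ) (x : Torus) : ℝ :=
  deriv (fun h : ℝ => g (x + proj (Pi.single j h))) 0

/-- Test functions: smooth functions on `𝕋² × [0, T)` with compact support
(they need not vanish at time `0`). -/
structure IsTestFunction (T : ℝ) (φ : ℝ → Torus → ℝ) : Prop where
  smooth : ContDiff ℝ ((⊤ : ℕ∞) : WithTop ℕ∞) (fun p : ℝ × (Fin 2 → ℝ) => φ p.1 (proj p.2))
  vanishes : ∃ T' < T, ∀ t, T' ≤ t → ∀ x, φ t x = 0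

/-- `θ` is an `H^s` solution on `𝕋² × [0, T]` of `∂ₜθ + u · ∇θ = 0`, `u = M^ν[θ]`, `θ(·, 0) = θ₀`:
it belongs to `L^∞(0, T; H^s) ∩ C([0, T]; L²)` and solves the system in the weak sense.
The value `θ t` represents an element of `L²(𝕋²)`; the case `ν = 0` is the IPM equation. -/
structure IsSolution (ν s T : ℝ) (θ₀ : Torus → ℝ) (θ : ℝ → Torus → ℝ) : Prop where
  initial : θ 0 =ᵐ[volume] θ₀
  memLp : ∀ t ∈ Icc 0 T, MemLp (θ t) 2 volume
  bounded : ∃ K : ℝ≥0, ∀ t ∈ Icc 0 T, sobolevNorm s (θ t) ≤ K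
  continuous : ∀ t ∈ Icc 0 T,
    Tendsto (fun τ => eLpNorm (θ τ - θ t) 2 volume) (𝓝[Icc 0 T] t) (𝓝 0)
  weak : ∀ φ : ℝ → Torus → ℝ, IsTestFunction T φ →
    (∫ t in (0 : ℝ)..T, ∫ x : Torus,
        (deriv (fun τ => φ τ x) t + ∑ j, velocity ν (θ t) x j * partialDeriv j (φ t) x) * θ t x)
      + ∫ x : Torus, φ 0 x * θ₀ x = 0

end IPMB

namespace IPMB

open MeasureTheory Filter Topology Set
open scoped Real NNReal ENNReal ComplexConjugate

/-! On the Fourier side the equation becomes the system `a_k' = -i ∑_l (k · M^ν(l)) a_l a_{k-l}`.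
Since `l · M^ν(l) = 0`, the factor `k` may be replaced by `k - l`. As the symbol is real and even
and `a` comes from a real function, transport is then antisymmetric (`im_tsum_transport_eq_zero`),
and in every energy identity only commutators survive.

Two estimates follow, with constants independent of `ν` because `|M^ν| ≤ 1`. Write `W(a) = ∑
⟨k⟩|a_k|`, finite on `H^s` exactly because `s > 2` in dimension two. First, the `H^s` norm grows at
a rate controlled by `W(a)` (`energy_le`, `FourierSolution.sobolevSq_le`). At regularity `s` the
energy sum cannot be differentiated directly, so the weight is truncated to `min(⟨k⟩, N)^s`, with a
commutator bound uniform in `N`. Second, the `ℓ²` distance between the solutions for `ν` and for `0`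
is `O(ν)`, with a constant depending only on the limit solution `e` (`energy_sub_le`,
`FourierSolution.tsum_sub_sq_le`). Replacing `M^ν` by `M^0` costs `ν⟨l⟩²`, which `e` in `H^s` pays
for.

The assumed `H^s` bounds need not be uniform in `ν`, so uniformity is obtained by a bootstrap
(`exists_uniform_bound`). Let `W(e) ≤ M`. While `W(a) ≤ M + 1`, the `H^s` norm of `a` has a bound
free of `ν`. Hence `W(a - e)` is a finite sum of coefficients, each `O(ν)`, plus a small tail, so
`W(a) ≤ M + 1/2` for small `ν`, and continuity in time closes the argument. The uniform `H^s` bound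
and the convergence of each coefficient then give convergence in `H^{s-1}`, again by cutting off a
tail. -/

/-- The Japanese bracket `⟨k⟩ = (1 + |k|²)^{1/2}`. -/
noncomputable def bracket (k : Fin 2 → ℤ) : ℝ := √(1 + normSq k)

/-! ### Elementary bounds for the Japanese bracket -/

lemma normSq_nonneg (k : Fin 2 → ℤ) : 0 ≤ normSq k := by unfold normSq; positivity

lemma bracket_sq (k : Fin 2 → ℤ) : bracket k ^ 2 = 1 + normSq k :=
  Real.sq_sqrt (by linarith [normSq_nonneg k])

lemma one_le_bracket (k : Fin 2 → ℤ) : 1 ≤ bracket k :=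
  Real.one_le_sqrt.2 (by linarith [normSq_nonneg k])

lemma bracket_pos (k : Fin 2 → ℤ) : 0 < bracket k := by linarith [one_le_bracket k]

lemma bracket_neg (k : Fin 2 → ℤ) : bracket (-k) = bracket k := by
  simp [bracket, normSq]

lemma bracket_add_le (j l : Fin 2 → ℤ) : bracket (j + l) ≤ bracket j + bracket l := by
  have h : (j 0 : ℝ) * l 0 + j 1 * l 1 ≤ bracket j * bracket l := by
    apply le_of_sq_le_sq _ (mul_pos (bracket_pos j) (bracket_pos l)).le
    rw [mul_pow, bracket_sq, bracket_sq]
    unfold normSq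
    nlinarith [sq_nonneg ((j 0 : ℝ) * l 1 - j 1 * l 0), sq_nonneg (j 0 : ℝ), sq_nonneg (j 1 : ℝ),
      sq_nonneg (l 0 : ℝ), sq_nonneg (l 1 : ℝ)]
  apply le_of_sq_le_sq _ (add_pos (bracket_pos j) (bracket_pos l)).le
  have hj := bracket_sq j
  have hl := bracket_sq l
  have hjl := bracket_sq (j + l)
  simp only [normSq, Pi.add_apply, Int.cast_add] at *
  nlinarith

lemma abs_apply_le_bracket (k : Fin 2 → ℤ) (i : Fin 2) : |(k i : ℝ)| ≤ bracket k := by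
  apply Real.abs_le_sqrt
  fin_cases i <;> simp [normSq] <;> nlinarith [sq_nonneg (k 0 : ℝ), sq_nonneg (k 1 : ℝ)]

lemma norm_le_bracket (k : Fin 2 → ℤ) : ‖k‖ ≤ bracket k := by
  refine (pi_norm_le_iff_of_nonneg (bracket_pos k).le).2 fun i => ?_
  rw [Int.norm_eq_abs]
  exact abs_apply_le_bracket k i

/-- Comparison with the Eisenstein sum of `‖k‖ ^ (-r)`, which converges on `ℤ²` for `r > 2`. That
sum gives no bound at `k = 0`; the added indicator does. -/
lemma summable_bracket_rpow {r : ℝ} (hr : 2 < r) :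
    Summable fun k : Fin 2 → ℤ => bracket k ^ (-r) := by
  have h := (EisensteinSeries.summable_one_div_norm_rpow hr).add
    (summable_of_ne_finset_zero (f := fun k : Fin 2 → ℤ => if k = 0 then (1 : ℝ) else 0)
      (s := {0}) (fun k hk => by simp at hk; simp [hk]))
  refine h.of_nonneg_of_le (fun k => Real.rpow_nonneg (bracket_pos k).le _) fun k => ?_
  by_cases hk : k = 0
  · have : bracket k ^ (-r) ≤ 1 :=
      Real.rpow_le_one_of_one_le_of_nonpos (one_le_bracket k) (by linarith)
    have h2 := Real.rpow_nonneg (norm_nonneg k) (-r)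
    rw [if_pos hk]
    linarith
  · rw [if_neg hk, add_zero]
    exact Real.rpow_le_rpow_of_nonpos (norm_pos_iff.2 hk) (norm_le_bracket k) (by linarith)

lemma tendsto_bracket_inv_cofinite :
    Tendsto (fun k : Fin 2 → ℤ => (bracket k)⁻¹) cofinite (𝓝 0) := by
  have h := (summable_bracket_rpow (r := 3) (by norm_num)).tendsto_cofinite_zero
  have h2 := h.rpow_const (p := 1 / 3) (Or.inr (by norm_num))
  rw [Real.zero_rpow (by norm_num)] at h2
  refine h2.congr fun k => ?_
  rw [← Real.rpow_mul (bracket_pos k).le, ← Real.rpow_neg_one]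
  norm_num

/-! ### The truncated weight -/

lemma abs_rpow_sub_rpow_le {s M x y : ℝ} (hs : 1 ≤ s) (hx : x ∈ Icc 0 M) (hy : y ∈ Icc 0 M) :
    |x ^ s - y ^ s| ≤ s * M ^ (s - 1) * |x - y| := by
  refine (convex_Icc 0 M).norm_image_sub_le_of_norm_hasDerivWithin_le
    (f := fun x : ℝ => x ^ s) (f' := fun x => s * x ^ (s - 1))
    (fun z _ => (Real.hasDerivAt_rpow_const (Or.inr hs)).hasDerivWithinAt) (fun z hz => ?_) hy hx
  rw [Real.norm_eq_abs, abs_of_nonneg (mul_nonneg (by linarith) (Real.rpow_nonneg hz.1 _))]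
  exact mul_le_mul_of_nonneg_left (Real.rpow_le_rpow hz.1 hz.2 (by linarith)) (by linarith)

/-- Scalar form of the commutator estimate, to be read with `x = ⟨k⟩`, `y = ⟨k - l⟩`, `z = ⟨l⟩`. The
constant does not depend on `N`, which later allows the truncation to be removed. -/
lemma abs_min_rpow_sub_mul_le {s N x y z : ℝ} (hs : 1 ≤ s) (hN : 0 < N) (hx : 0 < x) (hy : 0 < y)
    (hz : 0 < z) (hxy : x ≤ y + z) (hyx : y ≤ x + z) :
    |min x N ^ s - min y N ^ s| * y ≤
      (2 * (2 ^ s + 1) + s * 2 ^ s) * (z * min y N ^ s + y * min z N ^ s) := by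
  have hX : 0 < min x N := lt_min hx hN
  have hY : 0 < min y N := lt_min hy hN
  have hZ : 0 < min z N := lt_min hz hN
  have hXs := Real.rpow_pos_of_pos hX s
  have hYs := Real.rpow_pos_of_pos hY s
  have hZs := Real.rpow_pos_of_pos hZ s
  have h2s : (0 : ℝ) < 2 ^ s := by positivity
  -- If `y ≤ 2z`, the difference is not exploited: both weights are bounded by those of `y` and `z`.
  -- If `y > 2z`, then `x` and `y` are comparable and the mean value inequality gains the factor
  -- `z`.
  rcases le_or_gt y (2 * z) with h | h
  · have h1 : min x N ^ s ≤ 2 ^ s * (min y N ^ s + min z N ^ s) := by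
      have h3 : min x N ≤ 2 * max (min y N) (min z N) := by
        rcases le_total y z with hyz | hyz
        · rw [max_eq_right (min_le_min_right N hyz)]
          rcases le_total z N with hzN | hzN
          · rw [min_eq_left hzN]; exact (min_le_left _ _).trans (by linarith)
          · rw [min_eq_right hzN]; exact (min_le_right _ _).trans (by linarith)
        · rw [max_eq_left (min_le_min_right N hyz)]
          rcases le_total y N with hzN | hzN
          · rw [min_eq_left hzN]; exact (min_le_left _ _).trans (by linarith)
          · rw [min_eq_right hzN]; exact (min_le_right _ _).trans (by linarith)
      calc min x N ^ s ≤ (2 * max (min y N) (min z N)) ^ s :=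
            Real.rpow_le_rpow hX.le h3 (by linarith)
        _ = 2 ^ s * max (min y N) (min z N) ^ s := Real.mul_rpow (by norm_num) (by positivity)
        _ ≤ _ := by
            gcongr
            rcases max_choice (min y N) (min z N) with h | h <;> rw [h] <;> linarith
    have h2 : |min x N ^ s - min y N ^ s| ≤ (2 ^ s + 1) * min y N ^ s + 2 ^ s * min z N ^ s := by
      rw [abs_le]; constructor <;> nlinarith
    calc |min x N ^ s - min y N ^ s| * y
        ≤ ((2 ^ s + 1) * min y N ^ s + 2 ^ s * min z N ^ s) * y := by gcongr
      _ = (2 ^ s + 1) * min y N ^ s * y + 2 ^ s * min z N ^ s * y := by ring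
      _ ≤ (2 ^ s + 1) * min y N ^ s * (2 * z) + 2 ^ s * min z N ^ s * y := by gcongr
      _ ≤ _ := by
        have e1 : 0 ≤ s * 2 ^ s * (z * min y N ^ s + y * min z N ^ s) := by positivity
        have e2 : 0 ≤ (2 ^ s + 2) * (y * min z N ^ s) := by positivity
        nlinarith
  · have hmain : |min x N ^ s - min y N ^ s| * y ≤ s * 2 ^ s * (z * min y N ^ s) := by
      -- When both weights are truncated their difference vanishes. Otherwise `y` is comparable with
      -- `min y N`: if `x < N ≤ y`, then `y ≤ x + z < N + y / 2`.
      by_cases hc : N ≤ x ∧ N ≤ y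
      · rw [min_eq_right hc.1, min_eq_right hc.2]
        simp only [sub_self, abs_zero, zero_mul]
        positivity
      · have hy2 : y ≤ 2 * min y N := by
          rcases le_total y N with hyN | hyN
          · rw [min_eq_left hyN]; linarith
          · rw [min_eq_right hyN]
            have : x < N := by by_contra hcon; exact hc ⟨not_lt.1 hcon, hyN⟩
            linarith
        have hX2 : min x N ≤ 2 * min y N := by
          rcases le_total y N with hyN | hyN
          · rw [min_eq_left hyN]; exact (min_le_left _ _).trans (by linarith)
          · rw [min_eq_right hyN]; exact (min_le_right _ _).trans (by linarith)
        have hd : |min x N - min y N| ≤ z := by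
          refine (abs_min_sub_min_le_max x N y N).trans ?_
          rw [sub_self, abs_zero]
          exact max_le (abs_le.2 ⟨by linarith, by linarith⟩) hz.le
        calc |min x N ^ s - min y N ^ s| * y
            ≤ (s * (2 * min y N) ^ (s - 1) * z) * (2 * min y N) := by
              gcongr
              refine (abs_rpow_sub_rpow_le (M := 2 * min y N) hs ⟨hX.le, hX2⟩
                ⟨hY.le, by linarith⟩).trans ?_
              gcongr
          _ = s * z * ((2 * min y N) ^ (s - 1) * (2 * min y N)) := by ring
          _ = s * z * (2 * min y N) ^ s := by
              rw [← Real.rpow_add_one (by positivity), sub_add_cancel]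
          _ = _ := by rw [Real.mul_rpow (by norm_num) hY.le]; ring
    have : 0 ≤ 2 * (2 ^ s + 1) * (z * min y N ^ s + y * min z N ^ s) := by positivity
    have : 0 ≤ s * 2 ^ s * (y * min z N ^ s) := by positivity
    nlinarith

/-- The weight `min(⟨k⟩, N)^s`, a bounded truncation of `⟨k⟩^s`. -/
noncomputable def truncWeight (s N : ℝ) (k : Fin 2 → ℤ) : ℝ := min (bracket k) N ^ s

lemma truncWeight_nonneg {s N : ℝ} (hN : 0 < N) (k : Fin 2 → ℤ) : 0 ≤ truncWeight s N k :=
  Real.rpow_nonneg (le_min (bracket_pos k).le hN.le) _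

lemma truncWeight_le_bracket {s N : ℝ} (hs : 0 ≤ s) (hN : 0 < N) (k : Fin 2 → ℤ) :
    truncWeight s N k ≤ bracket k ^ s :=
  Real.rpow_le_rpow (le_min (bracket_pos k).le hN.le) (min_le_left _ _) hs

lemma truncWeight_le {s N : ℝ} (hs : 0 ≤ s) (hN : 0 < N) (k : Fin 2 → ℤ) :
    truncWeight s N k ≤ N ^ s :=
  Real.rpow_le_rpow (le_min (bracket_pos k).le hN.le) (min_le_right _ _) hs

/-- The constant in the commutator estimate for the truncated weights. -/
noncomputable def commConst (s : ℝ) : ℝ := 2 * (2 ^ s + 1) + s * 2 ^ s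

lemma commConst_nonneg {s : ℝ} (hs : 0 ≤ s) : 0 ≤ commConst s := by
  unfold commConst; positivity

/-- The bracket on the left is the derivative falling on the transported factor. On the right each
term has one bracket and one weight, placed on different factors, the form that `young` and `young'`
accept. -/
lemma abs_truncWeight_sub_mul_le {s N : ℝ} (hs : 1 ≤ s) (hN : 0 < N) (k l : Fin 2 → ℤ) :
    |truncWeight s N k - truncWeight s N (k - l)| * bracket (k - l) ≤
      commConst s * (bracket l * truncWeight s N (k - l) + bracket (k - l) * truncWeight s N l) := by
  refine abs_min_rpow_sub_mul_le hs hN (bracket_pos _) (bracket_pos _) (bracket_pos _) ?_ ?_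
  · simpa using bracket_add_le (k - l) l
  · simpa [bracket_neg, sub_eq_add_neg] using bracket_add_le k (-l)

/-! ### The transport symbol -/

/-- The symbol `k · M^ν(l)` of the transport term. -/
noncomputable def kernel (ν : ℝ) (k l : Fin 2 → ℤ) : ℝ := ∑ j, (k j : ℝ) * symbol ν l j

lemma kernel_eq (ν : ℝ) (k l : Fin 2 → ℤ) :
    kernel ν k l = 1 / (1 + ν * normSq l) * kernel 0 k l := by
  simp [kernel, symbol, Fin.sum_univ_two]; ring

/-- Incompressibility of the velocity. It lets the derivative in the convolution fall on the factor
with frequency `k - l`. -/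
lemma kernel_self (ν : ℝ) (l : Fin 2 → ℤ) : kernel ν l l = 0 := by
  simp [kernel, symbol, Fin.sum_univ_two]; ring

lemma kernel_sub_left (ν : ℝ) (k l : Fin 2 → ℤ) : kernel ν (k - l) l = kernel ν k l := by
  have h := kernel_self ν l
  simp only [kernel, Fin.sum_univ_two, Pi.sub_apply, Int.cast_sub] at *
  linarith

lemma kernel_neg_right (ν : ℝ) (k l : Fin 2 → ℤ) : kernel ν k (-l) = kernel ν k l := by
  simp [kernel, symbol, normSq, Fin.sum_univ_two]

lemma abs_symbol_zero_le (l : Fin 2 → ℤ) (j : Fin 2) : |symbol 0 l j| ≤ 1 := by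
  have hn := normSq_nonneg l
  have key : ∀ x : ℝ, |x| ≤ normSq l → |x / normSq l| ≤ 1 := fun x hx => by
    rw [abs_div, abs_of_nonneg hn]
    exact div_le_one_of_le₀ hx hn
  fin_cases j
  · simp only [symbol, zero_mul, add_zero, div_one, one_mul, Fin.zero_eta, Matrix.cons_val_zero]
    apply key
    rw [abs_le]; unfold normSq
    constructor <;> nlinarith [sq_nonneg ((l 0 : ℝ) + l 1), sq_nonneg ((l 0 : ℝ) - l 1)]
  · simp only [symbol, zero_mul, add_zero, div_one, one_mul, Fin.mk_one, Matrix.cons_val_one,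
      Matrix.cons_val_fin_one]
    apply key
    rw [abs_neg, abs_of_nonneg (sq_nonneg _)]; unfold normSq
    nlinarith [sq_nonneg (l 1 : ℝ)]

lemma abs_factor_le {ν : ℝ} (hν : 0 ≤ ν) (l : Fin 2 → ℤ) : |1 / (1 + ν * normSq l)| ≤ 1 := by
  have := mul_nonneg hν (normSq_nonneg l)
  rw [abs_of_nonneg (by positivity)]
  exact div_le_one_of_le₀ (by linarith) (by linarith)

lemma abs_symbol_le {ν : ℝ} (hν : 0 ≤ ν) (l : Fin 2 → ℤ) (j : Fin 2) : |symbol ν l j| ≤ 1 := by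
  have h : symbol ν l j = 1 / (1 + ν * normSq l) * symbol 0 l j := by
    fin_cases j <;> simp [symbol]
  rw [h, abs_mul]
  exact mul_le_one₀ (abs_factor_le hν l) (abs_nonneg _) (abs_symbol_zero_le l j)

lemma abs_kernel_le_bracket {ν : ℝ} (hν : 0 ≤ ν) (k l : Fin 2 → ℤ) :
    |kernel ν k l| ≤ 2 * bracket k := by
  have key : ∀ j, |(k j : ℝ) * symbol ν l j| ≤ bracket k := fun j => by
    rw [abs_mul]
    exact (mul_le_of_le_one_right (abs_nonneg _) (abs_symbol_le hν l j)).trans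
      (abs_apply_le_bracket k j)
  rw [kernel, Fin.sum_univ_two]
  linarith [abs_add_le ((k 0 : ℝ) * symbol ν l 0) ((k 1 : ℝ) * symbol ν l 1), key 0, key 1]

lemma abs_kernel_le_bracket_sub {ν : ℝ} (hν : 0 ≤ ν) (k l : Fin 2 → ℤ) :
    |kernel ν k l| ≤ 2 * bracket (k - l) := by
  rw [← kernel_sub_left]; exact abs_kernel_le_bracket hν _ _

/-- The relative error of the symbol is `ν|l|² / (1 + ν|l|²) ≤ ν⟨l⟩²`: first order in `ν`, at the
price of two derivatives on the factor with frequency `l`. -/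
lemma abs_kernel_sub_kernel_zero_le {ν : ℝ} (hν : 0 ≤ ν) (k l : Fin 2 → ℤ) :
    |kernel ν k l - kernel 0 k l| ≤ 2 * bracket (k - l) * (ν * bracket l ^ 2) := by
  have hn := mul_nonneg hν (normSq_nonneg l)
  have h : kernel ν k l - kernel 0 k l
      = -(kernel 0 k l * (ν * normSq l / (1 + ν * normSq l))) := by
    rw [kernel_eq ν]; field_simp; ring
  rw [h, abs_neg, abs_mul]
  refine mul_le_mul (abs_kernel_le_bracket_sub le_rfl k l) ?_ (abs_nonneg _)
    (by linarith [bracket_pos (k - l)])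
  rw [abs_of_nonneg (by positivity), bracket_sq]
  refine (div_le_self hn (by linarith)).trans ?_
  nlinarith
/-! ### Sequences with Sobolev decay -/

/-- Square summability of `⟨k⟩^s a k`. -/
def SobolevSeq (s : ℝ) (a : (Fin 2 → ℤ) → ℂ) : Prop :=
  Summable fun k => (bracket k ^ s * ‖a k‖) ^ 2

/-- The squared Sobolev norm of a sequence of Fourier coefficients. -/
noncomputable def sobolevSq (s : ℝ) (a : (Fin 2 → ℤ) → ℂ) : ℝ :=
  ∑' k, (bracket k ^ s * ‖a k‖) ^ 2

/-- The weighted Wiener norm `∑ ⟨k⟩ |a k|`. -/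
noncomputable def wienerNorm (a : (Fin 2 → ℤ) → ℂ) : ℝ := ∑' k, bracket k * ‖a k‖

lemma sobolevSq_nonneg (s : ℝ) (a : (Fin 2 → ℤ) → ℂ) : 0 ≤ sobolevSq s a :=
  tsum_nonneg fun _ => sq_nonneg _

lemma wienerNorm_nonneg (a : (Fin 2 → ℤ) → ℂ) : 0 ≤ wienerNorm a :=
  tsum_nonneg fun k => mul_nonneg (bracket_pos k).le (norm_nonneg _)

lemma SobolevSeq.sq_le {s : ℝ} {a : (Fin 2 → ℤ) → ℂ} (h : SobolevSeq s a) (k : Fin 2 → ℤ) :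
    (bracket k ^ s * ‖a k‖) ^ 2 ≤ sobolevSq s a :=
  h.le_tsum k fun _ _ => sq_nonneg _

lemma norm_le_of_sobolevSq_le {s K : ℝ} {a : (Fin 2 → ℤ) → ℂ} (h : SobolevSeq s a)
    (hK : sobolevSq s a ≤ K) (k : Fin 2 → ℤ) : ‖a k‖ ≤ √K * bracket k ^ (-s) := by
  rw [Real.rpow_neg (bracket_pos k).le, ← div_eq_mul_inv,
    le_div_iff₀ (Real.rpow_pos_of_pos (bracket_pos k) s), mul_comm]
  exact Real.le_sqrt_of_sq_le ((h.sq_le k).trans hK)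

lemma sq_bracket_rpow_le {r s : ℝ} (hrs : r ≤ s) (k : Fin 2 → ℤ) {x : ℝ} (hx : 0 ≤ x) :
    (bracket k ^ r * x) ^ 2 ≤ (bracket k ^ s * x) ^ 2 := by
  have h0 := bracket_pos k
  gcongr
  exact one_le_bracket k

lemma SobolevSeq.mono {r s : ℝ} {a : (Fin 2 → ℤ) → ℂ} (h : SobolevSeq s a) (hrs : r ≤ s) :
    SobolevSeq r a :=
  h.of_nonneg_of_le (fun _ => sq_nonneg _) fun k => sq_bracket_rpow_le hrs k (norm_nonneg _)

lemma SobolevSeq.sobolevSq_mono {r s : ℝ} {a : (Fin 2 → ℤ) → ℂ} (h : SobolevSeq s a)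
    (hrs : r ≤ s) : sobolevSq r a ≤ sobolevSq s a :=
  (h.mono hrs).tsum_le_tsum (fun k => sq_bracket_rpow_le hrs k (norm_nonneg _)) h

/-- Weighted AM-GM after splitting `⟨k⟩^r = ⟨k⟩^(r-s) ⟨k⟩^s`. The parameter `c` is kept free so that
tails can be balanced. -/
lemma bracket_rpow_mul_le {r s c : ℝ} (hc : 0 < c) (k : Fin 2 → ℤ) (x : ℝ) :
    bracket k ^ r * x ≤ (c⁻¹ * bracket k ^ (-(2 * (s - r))) + c * (bracket k ^ s * x) ^ 2) / 2 := by
  have h0 := bracket_pos k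
  have e1 : bracket k ^ (-(2 * (s - r))) = (bracket k ^ (r - s)) ^ 2 := by
    rw [← Real.rpow_natCast, ← Real.rpow_mul h0.le]; congr 1; push_cast; ring
  have e2 : bracket k ^ r * x = bracket k ^ (r - s) * (bracket k ^ s * x) := by
    rw [← mul_assoc, ← Real.rpow_add h0, sub_add_cancel]
  rw [e1, e2]
  set u := bracket k ^ (r - s)
  set v := bracket k ^ s * x
  have : c⁻¹ * u ^ 2 + c * v ^ 2 - 2 * (u * v) = c⁻¹ * (u - c * v) ^ 2 := by
    field_simp; ring
  have h3 : 0 ≤ c⁻¹ * (u - c * v) ^ 2 := by positivity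
  linarith

/-- The condition `r + 1 < s` makes the exponent `2(s - r)` exceed the dimension two. The case `r =
1` is where `s > 2` is needed. -/
lemma SobolevSeq.summable_bracket {r s : ℝ} {a : (Fin 2 → ℤ) → ℂ} (h : SobolevSeq s a)
    (hrs : r + 1 < s) : Summable fun k => bracket k ^ r * ‖a k‖ := by
  have h1 := ((summable_bracket_rpow (r := 2 * (s - r)) (by linarith)).mul_left (1⁻¹ : ℝ)).add
    (h.mul_left 1) |>.div_const 2
  exact h1.of_nonneg_of_le
    (fun k => mul_nonneg (Real.rpow_nonneg (bracket_pos k).le _) (norm_nonneg _))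
    fun k => bracket_rpow_mul_le one_pos k _

lemma SobolevSeq.summable_wiener {s : ℝ} {a : (Fin 2 → ℤ) → ℂ} (h : SobolevSeq s a)
    (hs : 2 < s) : Summable fun k => bracket k * ‖a k‖ := by
  simpa using h.summable_bracket (r := 1) (by linarith)

lemma SobolevSeq.summable_norm {s : ℝ} {a : (Fin 2 → ℤ) → ℂ} (h : SobolevSeq s a)
    (hs : 2 < s) : Summable fun k => ‖a k‖ := by
  simpa using h.summable_bracket (r := 0) (by linarith)

lemma SobolevSeq.summable_norm_sq {s : ℝ} {a : (Fin 2 → ℤ) → ℂ} (h : SobolevSeq s a)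
    (hs : 2 < s) : Summable fun k => ‖a k‖ ^ 2 := by
  simpa [SobolevSeq] using h.mono (r := 0) (by linarith)

lemma SobolevSeq.summable_wiener_sq {s : ℝ} {a : (Fin 2 → ℤ) → ℂ} (h : SobolevSeq s a)
    (hs : 2 < s) : Summable fun k => (bracket k * ‖a k‖) ^ 2 := by
  simpa [SobolevSeq] using h.mono (r := 1) (by linarith)

lemma add_sq_le_two (x y : ℝ) : (x + y) ^ 2 ≤ 2 * x ^ 2 + 2 * y ^ 2 := by
  nlinarith [sq_nonneg (x - y)]

lemma sq_bracket_norm_sub_le (s : ℝ) (a b : (Fin 2 → ℤ) → ℂ) (k : Fin 2 → ℤ) :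
    (bracket k ^ s * ‖(a - b) k‖) ^ 2 ≤
      2 * (bracket k ^ s * ‖a k‖) ^ 2 + 2 * (bracket k ^ s * ‖b k‖) ^ 2 := by
  have h0 := Real.rpow_nonneg (bracket_pos k).le s
  refine le_trans ?_ (add_sq_le_two _ _)
  rw [← mul_add]
  gcongr
  exact norm_sub_le _ _

lemma SobolevSeq.sub {s : ℝ} {a b : (Fin 2 → ℤ) → ℂ} (ha : SobolevSeq s a)
    (hb : SobolevSeq s b) : SobolevSeq s (a - b) :=
  ((ha.mul_left 2).add (hb.mul_left 2)).of_nonneg_of_le (fun _ => sq_nonneg _)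
    (sq_bracket_norm_sub_le s a b)

lemma SobolevSeq.sobolevSq_sub_le {s : ℝ} {a b : (Fin 2 → ℤ) → ℂ} (ha : SobolevSeq s a)
    (hb : SobolevSeq s b) : sobolevSq s (a - b) ≤ 2 * sobolevSq s a + 2 * sobolevSq s b := by
  unfold sobolevSq
  rw [← tsum_mul_left, ← tsum_mul_left,
    ← (Summable.mul_left 2 ha).tsum_add (Summable.mul_left 2 hb)]
  exact (ha.sub hb).tsum_le_tsum (sq_bracket_norm_sub_le s a b)
    ((Summable.mul_left 2 ha).add (Summable.mul_left 2 hb))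

/-- The Wiener norm of an `H^s`-bounded sequence is controlled by finitely many coefficients. -/
lemma exists_finset_wienerNorm_le {s : ℝ} (hs : 2 < s) (K : ℝ) {ε : ℝ} (hε : 0 < ε) :
    ∃ F : Finset (Fin 2 → ℤ), ∀ b, SobolevSeq s b → sobolevSq s b ≤ K →
      wienerNorm b ≤ ∑ k ∈ F, bracket k * ‖b k‖ + ε := by
  have hK : 0 < |K| + 1 := by positivity
  -- Balanced so that each half of the AM-GM bound is at most `ε`: the set `F` leaves a tail of the
  -- bracket sum below `c * ε`, and `c * (|K| + 1) = ε`.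
  set c := ε / (|K| + 1) with hc
  have hc0 : 0 < c := div_pos hε hK
  have hsum := summable_bracket_rpow (r := 2 * (s - 1)) (by linarith)
  obtain ⟨F, hF⟩ := ((tendsto_order.1 (tendsto_tsum_compl_atTop_zero
    (fun k => bracket k ^ (-(2 * (s - 1)))))).2 (c * ε) (by positivity)).exists
  refine ⟨F, fun b hb hbK => ?_⟩
  have hW := hb.summable_wiener hs
  have hX : Summable fun k : {k // k ∉ F} => (bracket k.1 ^ s * ‖b k‖) ^ 2 := hb.subtype _
  have hY : Summable fun k : {k // k ∉ F} => bracket k.1 ^ (-(2 * (s - 1))) := hsum.subtype _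
  have h1 : ∑' k : {k // k ∉ F}, (bracket k.1 ^ s * ‖b k‖) ^ 2 ≤ K :=
    (Summable.tsum_subtype_le (fun k => (bracket k ^ s * ‖b k‖) ^ 2) {k | k ∉ F}
      (fun _ => sq_nonneg _) hb).trans hbK
  have h2 : ∑' k : {k // k ∉ F}, bracket k.1 * ‖b k‖ ≤ ε := by
    calc ∑' k : {k // k ∉ F}, bracket k.1 * ‖b k‖
        ≤ ∑' k : {k // k ∉ F}, (c⁻¹ * bracket k.1 ^ (-(2 * (s - 1)))
            + c * (bracket k.1 ^ s * ‖b k‖) ^ 2) / 2 := by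
          refine Summable.tsum_le_tsum (fun k => ?_) (hW.subtype _)
            (((hY.mul_left _).add (hX.mul_left _)).div_const 2)
          simpa using bracket_rpow_mul_le (r := 1) (s := s) hc0 k.1 ‖b k‖
      _ = (c⁻¹ * (∑' k : {k // k ∉ F}, bracket k.1 ^ (-(2 * (s - 1))))
            + c * ∑' k : {k // k ∉ F}, (bracket k.1 ^ s * ‖b k‖) ^ 2) / 2 := by
          rw [tsum_div_const, (hY.mul_left _).tsum_add (hX.mul_left _), tsum_mul_left,
            tsum_mul_left]
      _ ≤ (c⁻¹ * (c * ε) + c * (|K| + 1)) / 2 := by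
          gcongr
          exact h1.trans (by linarith [le_abs_self K])
      _ = ε := by rw [hc]; field_simp; ring
  rw [wienerNorm, ← hW.sum_add_tsum_subtype_compl F]
  gcongr

/-- A lower Sobolev norm of an `H^s`-bounded sequence is controlled by finitely many coefficients. -/
lemma exists_finset_sobolevSq_le {r s : ℝ} (hrs : r + 1 ≤ s) (K : ℝ) {ε : ℝ} (hε : 0 < ε) :
    ∃ F : Finset (Fin 2 → ℤ), ∀ b, SobolevSeq s b → sobolevSq s b ≤ K →
      sobolevSq r b ≤ ∑ k ∈ F, (bracket k ^ r * ‖b k‖) ^ 2 + ε := by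
  have hK : 0 < |K| + 1 := by positivity
  set c := ε / (|K| + 1) with hc
  have hc0 : 0 < c := div_pos hε hK
  -- Off a finite set `⟨k⟩⁻² < c`; the spare derivative in `r + 1 ≤ s` turns this into a factor `c`
  -- on the tail.
  have hlim := tendsto_bracket_inv_cofinite.pow 2
  rw [zero_pow two_ne_zero] at hlim
  have hfin := (hlim.eventually (gt_mem_nhds hc0))
  rw [eventually_cofinite] at hfin
  refine ⟨hfin.toFinset, fun b hb hbK => ?_⟩
  set F := hfin.toFinset
  have hX : Summable fun k : {k // k ∉ F} => (bracket k.1 ^ s * ‖b k‖) ^ 2 := hb.subtype _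
  have hR := hb.mono (r := r) (by linarith)
  have h1 : ∑' k : {k // k ∉ F}, (bracket k.1 ^ s * ‖b k‖) ^ 2 ≤ K :=
    (Summable.tsum_subtype_le (fun k => (bracket k ^ s * ‖b k‖) ^ 2) {k | k ∉ F}
      (fun _ => sq_nonneg _) hb).trans hbK
  have h2 : ∑' k : {k // k ∉ F}, (bracket k.1 ^ r * ‖b k‖) ^ 2 ≤ ε := by
    calc ∑' k : {k // k ∉ F}, (bracket k.1 ^ r * ‖b k‖) ^ 2
        ≤ ∑' k : {k // k ∉ F}, c * (bracket k.1 ^ s * ‖b k‖) ^ 2 := by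
          refine Summable.tsum_le_tsum (fun k => ?_) (hR.subtype _) (hX.mul_left _)
          have hk : (bracket k.1)⁻¹ ^ 2 ≤ c := by
            have h := k.2
            simp only [F, Finite.mem_toFinset, mem_ofPred_eq, not_not] at h
            exact h.le
          have h0 := bracket_pos k.1
          have e : (bracket k.1)⁻¹ ^ 2 * (bracket k.1 ^ s * ‖b k‖) ^ 2
              = (bracket k.1 ^ (s - 1) * ‖b k‖) ^ 2 := by
            rw [Real.rpow_sub_one h0.ne']; field_simp
          calc (bracket k.1 ^ r * ‖b k‖) ^ 2 ≤ (bracket k.1 ^ (s - 1) * ‖b k‖) ^ 2 :=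
                sq_bracket_rpow_le (by linarith) _ (norm_nonneg _)
            _ ≤ _ := by rw [← e]; gcongr
      _ = c * ∑' k : {k // k ∉ F}, (bracket k.1 ^ s * ‖b k‖) ^ 2 := tsum_mul_left
      _ ≤ c * (|K| + 1) := by gcongr; exact h1.trans (by linarith [le_abs_self K])
      _ = ε := by rw [hc]; field_simp
  rw [sobolevSq, ← Summable.sum_add_tsum_subtype_compl hR F]
  gcongr

/-! ### Convolution sums -/

/-- The change of variables `(k, l) ↦ (k - l, l)`. -/
def shearEquiv : (Fin 2 → ℤ) × (Fin 2 → ℤ) ≃ (Fin 2 → ℤ) × (Fin 2 → ℤ) where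
  toFun p := (p.1 - p.2, p.2)
  invFun p := (p.1 + p.2, p.2)
  left_inv p := by simp
  right_inv p := by simp

/-- The involution `(k, l) ↦ (k - l, -l)`. -/
def swapEquiv : (Fin 2 → ℤ) × (Fin 2 → ℤ) ≃ (Fin 2 → ℤ) × (Fin 2 → ℤ) where
  toFun p := (p.1 - p.2, -p.2)
  invFun p := (p.1 - p.2, -p.2)
  left_inv p := by simp
  right_inv p := by simp

/-- The involution `(k, l) ↦ (k, k - l)`. -/
def reflectEquiv : (Fin 2 → ℤ) × (Fin 2 → ℤ) ≃ (Fin 2 → ℤ) × (Fin 2 → ℤ) where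
  toFun p := (p.1, p.1 - p.2)
  invFun p := (p.1, p.1 - p.2)
  left_inv p := by simp
  right_inv p := by simp

lemma hasSum_prod_mul {f g : (Fin 2 → ℤ) → ℝ} (hf : Summable f) (hg : Summable g)
    (hf0 : 0 ≤ f) (hg0 : 0 ≤ g) :
    HasSum (fun p : (Fin 2 → ℤ) × (Fin 2 → ℤ) => f p.1 * g p.2) ((∑' k, f k) * ∑' k, g k) :=
  hf.hasSum.mul hg.hasSum (hf.mul_of_nonneg hg hf0 hg0)

/-- Young's inequality for `ℓ² * ℓ¹ → ℓ²`, in dual form. -/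
lemma young {f g h : (Fin 2 → ℤ) → ℝ} (hf : Summable fun k => f k ^ 2)
    (hg : Summable fun k => g k ^ 2) (hh : Summable h) (hf0 : 0 ≤ f) (hg0 : 0 ≤ g) (hh0 : 0 ≤ h) :
    (Summable fun p : (Fin 2 → ℤ) × (Fin 2 → ℤ) => f p.1 * h p.2 * g (p.1 - p.2)) ∧
    ∑' p : (Fin 2 → ℤ) × (Fin 2 → ℤ), f p.1 * h p.2 * g (p.1 - p.2) ≤
      (∑' k, h k) * (((∑' k, f k ^ 2) + ∑' k, g k ^ 2) / 2) := by
  have h1 := hasSum_prod_mul hf hh (fun _ => sq_nonneg _) hh0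
  have h2 := (shearEquiv.hasSum_iff).2 (hasSum_prod_mul hg hh (fun _ => sq_nonneg _) hh0)
  have h3 := (h1.add h2).div_const 2
  -- AM-GM replaces Cauchy-Schwarz, so the bound is half the sum of the squared `ℓ²` norms rather
  -- than the product of the norms.
  have hle : ∀ p : (Fin 2 → ℤ) × (Fin 2 → ℤ), f p.1 * h p.2 * g (p.1 - p.2) ≤
      (f p.1 ^ 2 * h p.2 + ((fun p : (Fin 2 → ℤ) × (Fin 2 → ℤ) => g p.1 ^ 2 * h p.2) ∘ shearEquiv) p)
        / 2 := fun p => by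
    simp only [Function.comp, shearEquiv, Equiv.coe_fn_mk]
    nlinarith [mul_nonneg (hh0 p.2) (sq_nonneg (f p.1 - g (p.1 - p.2)))]
  have hs := h3.summable.of_nonneg_of_le
    (fun p => mul_nonneg (mul_nonneg (hf0 p.1) (hh0 p.2)) (hg0 _)) hle
  refine ⟨hs, (hs.tsum_le_tsum hle h3.summable).trans (le_of_eq ?_)⟩
  rw [h3.tsum_eq]; ring

lemma young' {f g h : (Fin 2 → ℤ) → ℝ} (hf : Summable fun k => f k ^ 2)
    (hg : Summable fun k => g k ^ 2) (hh : Summable h) (hf0 : 0 ≤ f) (hg0 : 0 ≤ g) (hh0 : 0 ≤ h) :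
    (Summable fun p : (Fin 2 → ℤ) × (Fin 2 → ℤ) => f p.1 * g p.2 * h (p.1 - p.2)) ∧
    ∑' p : (Fin 2 → ℤ) × (Fin 2 → ℤ), f p.1 * g p.2 * h (p.1 - p.2) ≤
      (∑' k, h k) * (((∑' k, f k ^ 2) + ∑' k, g k ^ 2) / 2) := by
  obtain ⟨h1, h2⟩ := young hf hg hh hf0 hg0 hh0
  have e : (fun p : (Fin 2 → ℤ) × (Fin 2 → ℤ) => f p.1 * g p.2 * h (p.1 - p.2)) =
      (fun p => f p.1 * h p.2 * g (p.1 - p.2)) ∘ reflectEquiv := by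
    funext p
    simp only [Function.comp, reflectEquiv, Equiv.coe_fn_mk, sub_sub_cancel]; ring
  rw [e]
  refine ⟨(reflectEquiv.summable_iff).2 h1, ?_⟩
  exact (reflectEquiv.tsum_eq (fun p : (Fin 2 → ℤ) × (Fin 2 → ℤ) =>
    f p.1 * h p.2 * g (p.1 - p.2))).trans_le h2

/-- Transport by a divergence free real field is antisymmetric. -/
lemma im_tsum_transport_eq_zero (ν : ℝ) {a : (Fin 2 → ℤ) → ℂ} (ha : ∀ k, a (-k) = conj (a k))
    (b : (Fin 2 → ℤ) → ℂ) :
    (∑' p : (Fin 2 → ℤ) × (Fin 2 → ℤ),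
      conj (b p.1) * ((kernel ν p.1 p.2 : ℂ) * a p.2 * b (p.1 - p.2))).im = 0 := by
  rw [← Complex.conj_eq_iff_im, Complex.conj_tsum]
  -- The substitution `(k, l) ↦ (k - l, -l)` carries the summand to its complex conjugate, so the
  -- sum is real.
  rw [← swapEquiv.tsum_eq (fun p : (Fin 2 → ℤ) × (Fin 2 → ℤ) =>
    conj (b p.1) * ((kernel ν p.1 p.2 : ℂ) * a p.2 * b (p.1 - p.2)))]
  refine tsum_congr fun p => ?_
  simp only [swapEquiv, Equiv.coe_fn_mk, kernel_neg_right, kernel_sub_left, ha, map_mul,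
    Complex.conj_conj, Complex.conj_ofReal, sub_neg_eq_add, sub_add_cancel]
  ring

/-! ### The nonlinearity -/

/-- The Fourier coefficients of `-u · ∇θ`. -/
noncomputable def nonlinearity (ν : ℝ) (a : (Fin 2 → ℤ) → ℂ) (k : Fin 2 → ℤ) : ℂ :=
  -Complex.I * ∑' l, (kernel ν k l : ℂ) * a l * a (k - l)

lemma summable_kernel_mul {ν : ℝ} (hν : 0 ≤ ν) {a b : (Fin 2 → ℤ) → ℂ}
    (ha : Summable fun k => ‖a k‖) (hb : Summable fun k => ‖b k‖) (k : Fin 2 → ℤ) :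
    Summable fun l => (kernel ν k l : ℂ) * a l * b (k - l) := by
  refine Summable.of_norm_bounded (g := fun l => 2 * bracket k * (∑' j, ‖b j‖) * ‖a l‖)
    (ha.mul_left _) fun l => ?_
  rw [norm_mul, norm_mul, Complex.norm_real, Real.norm_eq_abs]
  have h1 : ‖b (k - l)‖ ≤ ∑' j, ‖b j‖ := hb.le_tsum _ fun _ _ => norm_nonneg _
  have h2 := abs_kernel_le_bracket hν k l
  calc |kernel ν k l| * ‖a l‖ * ‖b (k - l)‖
      ≤ 2 * bracket k * ‖a l‖ * (∑' j, ‖b j‖) := by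
        gcongr
        exact mul_nonneg (by linarith [bracket_pos k]) (norm_nonneg _)
    _ = _ := by ring

/-- This is `⟨k⟩^s ≤ 2^s (⟨l⟩^s + ⟨k - l⟩^s)` divided by all three powers. It makes decay of order
`s > 2` stable under convolution. -/
lemma bracket_rpow_neg_mul_le {s : ℝ} (hs : 0 ≤ s) (k l : Fin 2 → ℤ) :
    bracket l ^ (-s) * bracket (k - l) ^ (-s) ≤
      2 ^ s * bracket k ^ (-s) * (bracket l ^ (-s) + bracket (k - l) ^ (-s)) := by
  have hk := bracket_pos k
  have hl := bracket_pos l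
  have hj := bracket_pos (k - l)
  have hkj : bracket k ≤ bracket l + bracket (k - l) := by simpa using bracket_add_le l (k - l)
  rw [Real.rpow_neg hk.le, Real.rpow_neg hl.le, Real.rpow_neg hj.le]
  have h1 : bracket k ^ s ≤ 2 ^ s * (bracket l ^ s + bracket (k - l) ^ s) := by
    calc bracket k ^ s ≤ (2 * max (bracket l) (bracket (k - l))) ^ s := by
          gcongr
          linarith [le_max_left (bracket l) (bracket (k - l)),
            le_max_right (bracket l) (bracket (k - l))]
      _ = 2 ^ s * max (bracket l) (bracket (k - l)) ^ s :=
          Real.mul_rpow (by norm_num) (le_max_of_le_left hl.le)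
      _ ≤ _ := by
          gcongr
          have e1 := Real.rpow_pos_of_pos hl s
          have e2 := Real.rpow_pos_of_pos hj s
          rcases max_choice (bracket l) (bracket (k - l)) with h | h <;> rw [h] <;> linarith
  have e0 := Real.rpow_pos_of_pos hk s
  have e1 := Real.rpow_pos_of_pos hl s
  have e2 := Real.rpow_pos_of_pos hj s
  have e3 : 2 ^ s * (bracket k ^ s)⁻¹ * ((bracket l ^ s)⁻¹ + (bracket (k - l) ^ s)⁻¹) =
      2 ^ s * (bracket l ^ s + bracket (k - l) ^ s) / bracket k ^ s *
        ((bracket l ^ s)⁻¹ * (bracket (k - l) ^ s)⁻¹) := by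
    field_simp; ring
  rw [e3]
  refine le_mul_of_one_le_left (by positivity) ?_
  rwa [one_le_div e0]

/-- Convolution preserves the decay `⟨k⟩^(-s)` and the kernel costs one factor `⟨k⟩`. The bound
dominates the time derivatives when the energy series is differentiated termwise. -/
lemma norm_nonlinearity_le {ν s A : ℝ} (hν : 0 ≤ ν) (hs : 2 < s) (hA : 0 ≤ A)
    {a : (Fin 2 → ℤ) → ℂ} (ha : ∀ k, ‖a k‖ ≤ A * bracket k ^ (-s)) (k : Fin 2 → ℤ) :
    ‖nonlinearity ν a k‖ ≤
      4 * A ^ 2 * 2 ^ s * (∑' l : Fin 2 → ℤ, bracket l ^ (-s)) * bracket k ^ (1 - s) := by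
  have hk := bracket_pos k
  have hS := summable_bracket_rpow hs
  have hS' : Summable fun l => bracket (k - l) ^ (-s) :=
    ((Equiv.subLeft k).summable_iff (f := fun l => bracket l ^ (-s))).2 hS
  have hT' : ∑' l, bracket (k - l) ^ (-s) = ∑' l, bracket l ^ (-s) :=
    (Equiv.subLeft k).tsum_eq (fun l => bracket l ^ (-s))
  set c := 2 * bracket k * A ^ 2 * (2 ^ s * bracket k ^ (-s)) with hc
  have hsum := ((hS.add hS').mul_left c).hasSum
  rw [tsum_mul_left, hS.tsum_add hS', hT'] at hsum
  rw [nonlinearity, norm_mul, norm_neg, Complex.norm_I, one_mul]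
  refine (tsum_of_norm_bounded hsum fun l => ?_).trans (le_of_eq ?_)
  · rw [norm_mul, norm_mul, Complex.norm_real, Real.norm_eq_abs]
    have e1 := Real.rpow_nonneg (bracket_pos l).le (-s)
    have e2 := Real.rpow_nonneg (bracket_pos (k - l)).le (-s)
    calc |kernel ν k l| * ‖a l‖ * ‖a (k - l)‖
        ≤ 2 * bracket k * (A * bracket l ^ (-s)) * (A * bracket (k - l) ^ (-s)) := by
          gcongr
          · exact abs_kernel_le_bracket hν k l
          · exact ha l
          · exact ha (k - l)
      _ = 2 * bracket k * A ^ 2 * (bracket l ^ (-s) * bracket (k - l) ^ (-s)) := by ring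
      _ ≤ 2 * bracket k * A ^ 2 *
          (2 ^ s * bracket k ^ (-s) * (bracket l ^ (-s) + bracket (k - l) ^ (-s))) := by
          exact mul_le_mul_of_nonneg_left (bracket_rpow_neg_mul_le (by linarith) k l)
            (by positivity)
      _ = _ := by rw [hc]; ring
  · rw [hc, show (1 - s : ℝ) = -s + 1 by ring, Real.rpow_add_one hk.ne']; ring
/-! ### Energy estimates at a fixed time -/

lemma re_conj_mul_neg_I_mul (x z : ℂ) : (conj x * (-Complex.I * z)).re = (conj x * z).im := by
  rw [show conj x * (-Complex.I * z) = -Complex.I * (conj x * z) by ring]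
  simp

/-- The energy estimate in the space with the truncated weight. -/
lemma energy_le {ν s N : ℝ} (hν : 0 ≤ ν) (hs : 2 < s) (hN : 0 < N) {a : (Fin 2 → ℤ) → ℂ}
    (ha : SobolevSeq s a) (hreal : ∀ k, a (-k) = conj (a k)) :
    ∑' k, truncWeight s N k ^ 2 * (conj (a k) * nonlinearity ν a k).re ≤
      4 * commConst s * wienerNorm a * ∑' k, truncWeight s N k ^ 2 * ‖a k‖ ^ 2 := by
  set m := truncWeight s N with hm
  have hm0 : ∀ k, 0 ≤ m k := truncWeight_nonneg hN
  have hN0 : 0 ≤ N ^ s := Real.rpow_nonneg hN.le _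
  have hmN : ∀ k, m k ≤ N ^ s := truncWeight_le (by linarith) hN
  have hW := ha.summable_wiener hs
  have hma : Summable fun k => (m k * ‖a k‖) ^ 2 := by
    refine ha.of_nonneg_of_le (fun _ => sq_nonneg _) fun k => ?_
    have := hm0 k
    gcongr
    exact truncWeight_le_bracket (by linarith) hN k
  -- The truncation is needed here: `m ≤ N^s` puts `m² ‖a‖` in `ℓ²`, so the full double sum
  -- converges absolutely. This `N`-dependent bound serves convergence only.
  have hmma : Summable fun k => (m k ^ 2 * ‖a k‖) ^ 2 := by
    refine (hma.mul_left ((N ^ s) ^ 2)).of_nonneg_of_le (fun _ => sq_nonneg _) fun k => ?_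
    have := hm0 k
    rw [← mul_pow, pow_two (m k), mul_assoc]
    gcongr
    exact hmN k
  set T : (Fin 2 → ℤ) × (Fin 2 → ℤ) → ℂ := fun p =>
    (m p.1 : ℂ) ^ 2 * (conj (a p.1) * ((kernel ν p.1 p.2 : ℂ) * a p.2 * a (p.1 - p.2))) with hT
  set T₁ : (Fin 2 → ℤ) × (Fin 2 → ℤ) → ℂ := fun p =>
    conj ((m p.1 : ℂ) * a p.1) *
      ((kernel ν p.1 p.2 : ℂ) * a p.2 * ((m (p.1 - p.2) : ℂ) * a (p.1 - p.2))) with hT₁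
  set T₂ : (Fin 2 → ℤ) × (Fin 2 → ℤ) → ℂ := fun p =>
    ((m p.1 * (m p.1 - m (p.1 - p.2)) : ℝ) : ℂ) * (conj (a p.1) *
      ((kernel ν p.1 p.2 : ℂ) * a p.2 * a (p.1 - p.2))) with hT₂
  -- From `m_k² = m_k m_{k-l} + m_k (m_k - m_{k-l})`: `T₁` is the antisymmetric transport form at `m
  -- a`, and `T₂` is the commutator.
  have hsplit : ∀ p, T p = T₁ p + T₂ p := fun p => by
    simp only [hT, hT₁, hT₂, map_mul, Complex.conj_ofReal]
    push_cast; ring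
  have hTs : Summable T := by
    refine Summable.of_norm_bounded (((young hmma (ha.summable_wiener_sq hs) (ha.summable_norm hs)
      (fun k => mul_nonneg (sq_nonneg _) (norm_nonneg _))
      (fun k => mul_nonneg (bracket_pos k).le (norm_nonneg _))
      (fun k => norm_nonneg _)).1).mul_left 2) fun p => ?_
    simp only [hT, norm_mul, norm_pow, Complex.norm_real, RCLike.norm_conj, Real.norm_eq_abs,
      sq_abs]
    calc m p.1 ^ 2 * (‖a p.1‖ * (|kernel ν p.1 p.2| * ‖a p.2‖ * ‖a (p.1 - p.2)‖))
        ≤ m p.1 ^ 2 * (‖a p.1‖ * (2 * bracket (p.1 - p.2) * ‖a p.2‖ * ‖a (p.1 - p.2)‖)) := by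
          gcongr
          exact abs_kernel_le_bracket_sub hν _ _
      _ = _ := by ring
  have y1 := young hma hma hW (fun k => mul_nonneg (hm0 k) (norm_nonneg _))
    (fun k => mul_nonneg (hm0 k) (norm_nonneg _))
    (fun k => mul_nonneg (bracket_pos k).le (norm_nonneg _))
  have y2 := young' hma hma hW (fun k => mul_nonneg (hm0 k) (norm_nonneg _))
    (fun k => mul_nonneg (hm0 k) (norm_nonneg _))
    (fun k => mul_nonneg (bracket_pos k).le (norm_nonneg _))
  have hb := (y1.1.add y2.1).mul_left (2 * commConst s)
  have hT₂le : ∀ p, ‖T₂ p‖ ≤ 2 * commConst s *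
      (m p.1 * ‖a p.1‖ * (bracket p.2 * ‖a p.2‖) * (m (p.1 - p.2) * ‖a (p.1 - p.2)‖) +
      m p.1 * ‖a p.1‖ * (m p.2 * ‖a p.2‖) * (bracket (p.1 - p.2) * ‖a (p.1 - p.2)‖)) := fun p => by
    simp only [hT₂, norm_mul, Complex.norm_real, RCLike.norm_conj, Real.norm_eq_abs,
      abs_of_nonneg (hm0 _)]
    have h0 := hm0 p.1
    calc m p.1 * |m p.1 - m (p.1 - p.2)| *
          (‖a p.1‖ * (|kernel ν p.1 p.2| * ‖a p.2‖ * ‖a (p.1 - p.2)‖))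
        ≤ m p.1 * |m p.1 - m (p.1 - p.2)| *
          (‖a p.1‖ * (2 * bracket (p.1 - p.2) * ‖a p.2‖ * ‖a (p.1 - p.2)‖)) := by
          gcongr
          exact abs_kernel_le_bracket_sub hν _ _
      _ = 2 * (m p.1 * ‖a p.1‖ * ‖a p.2‖ * ‖a (p.1 - p.2)‖) *
          (|m p.1 - m (p.1 - p.2)| * bracket (p.1 - p.2)) := by ring
      _ ≤ 2 * (m p.1 * ‖a p.1‖ * ‖a p.2‖ * ‖a (p.1 - p.2)‖) *
          (commConst s * (bracket p.2 * m (p.1 - p.2) + bracket (p.1 - p.2) * m p.2)) := by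
          refine mul_le_mul_of_nonneg_left
            (abs_truncWeight_sub_mul_le (by linarith) hN p.1 p.2) (by positivity)
      _ = _ := by ring
  have hT₂s : Summable T₂ := Summable.of_norm_bounded hb hT₂le
  have hT₂n : ‖∑' p, T₂ p‖ ≤ 4 * commConst s * wienerNorm a * ∑' k, (m k * ‖a k‖) ^ 2 := by
    refine (tsum_of_norm_bounded hb.hasSum hT₂le).trans ?_
    rw [tsum_mul_left, y1.1.tsum_add y2.1]
    have hc := commConst_nonneg (s := s) (by linarith)
    have e := mul_le_mul_of_nonneg_left (add_le_add y1.2 y2.2) (mul_nonneg two_pos.le hc)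
    refine e.trans (le_of_eq ?_)
    rw [wienerNorm]; ring
  have hT₁s : Summable T₁ := by
    refine (hTs.sub hT₂s).congr fun p => ?_
    rw [hsplit]; ring
  have him : (∑' p, T p).im = (∑' p, T₂ p).im := by
    rw [tsum_congr hsplit, hT₁s.tsum_add hT₂s, Complex.add_im,
      im_tsum_transport_eq_zero ν hreal (fun k => (m k : ℂ) * a k), zero_add]
  have hL : ∑' k, m k ^ 2 * (conj (a k) * nonlinearity ν a k).re = (∑' p, T p).im := by
    rw [hTs.tsum_prod, Complex.im_tsum hTs.prod]
    refine tsum_congr fun k => ?_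
    simp only [hT]
    rw [tsum_mul_left, tsum_mul_left, nonlinearity, re_conj_mul_neg_I_mul, ← Complex.ofReal_pow,
      Complex.im_ofReal_mul]
  rw [hL, him]
  simp_rw [← mul_pow]
  exact (le_abs_self _).trans ((Complex.abs_im_le_norm _).trans hT₂n)

/-- The `L²` estimate for the difference of two solutions. -/
lemma energy_sub_le {ν s : ℝ} (hν : 0 ≤ ν) (hs : 2 < s) {a e : (Fin 2 → ℤ) → ℂ}
    (ha : SobolevSeq s a) (he : SobolevSeq s e) (hreal : ∀ k, a (-k) = conj (a k)) :
    ∑' k, (conj ((a - e) k) * (nonlinearity ν a k - nonlinearity 0 e k)).re ≤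
      wienerNorm e * (3 * ∑' k, ‖(a - e) k‖ ^ 2 + 2 * ν ^ 2 * sobolevSq s e) := by
  set d := a - e with hd
  have hds : SobolevSeq s d := ha.sub he
  have hW := he.summable_wiener hs
  have hd2 := hds.summable_norm_sq hs
  have he2 : Summable fun k => (bracket k ^ 2 * ‖e k‖) ^ 2 := by
    simpa [SobolevSeq] using he.mono (r := 2) hs.le
  have he2le : ∑' k, (bracket k ^ 2 * ‖e k‖) ^ 2 ≤ sobolevSq s e := by
    simpa [sobolevSq] using he.sobolevSq_mono (r := 2) hs.le
  -- Both sources of velocity error: the difference of the solutions and the change of symbol acting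
  -- on `e`.
  set g : (Fin 2 → ℤ) → ℝ := fun k => ‖d k‖ + ν * (bracket k ^ 2 * ‖e k‖) with hg
  have hgle : ∀ k, g k ^ 2 ≤ 2 * ‖d k‖ ^ 2 + 2 * ν ^ 2 * (bracket k ^ 2 * ‖e k‖) ^ 2 := fun k => by
    refine (add_sq_le_two _ _).trans (le_of_eq ?_)
    ring
  have hgb := (hd2.mul_left 2).add (he2.mul_left (2 * ν ^ 2))
  have hg2 : Summable fun k => g k ^ 2 := hgb.of_nonneg_of_le (fun _ => sq_nonneg _) hgle
  have hg2le : ∑' k, g k ^ 2 ≤ 2 * ∑' k, ‖d k‖ ^ 2 + 2 * ν ^ 2 * sobolevSq s e := by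
    refine (hg2.tsum_le_tsum hgle hgb).trans ?_
    rw [(hd2.mul_left 2).tsum_add (he2.mul_left (2 * ν ^ 2)), tsum_mul_left, tsum_mul_left]
    gcongr
  -- `T₁` is transport of `d` by the velocity of `a` and drops out by antisymmetry. `T₂` is
  -- transport of `e` by the velocity difference; its derivative falls on `e`, so no Wiener norm of
  -- `a` enters.
  set T₁ : (Fin 2 → ℤ) × (Fin 2 → ℤ) → ℂ := fun p =>
    conj (d p.1) * ((kernel ν p.1 p.2 : ℂ) * a p.2 * d (p.1 - p.2)) with hT₁
  set T₂ : (Fin 2 → ℤ) × (Fin 2 → ℤ) → ℂ := fun p =>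
    conj (d p.1) *
      (((kernel ν p.1 p.2 : ℂ) * a p.2 - (kernel 0 p.1 p.2 : ℂ) * e p.2) * e (p.1 - p.2)) with hT₂
  have hT₁s : Summable T₁ := by
    refine Summable.of_norm_bounded (((young hd2 (hds.summable_wiener_sq hs) (ha.summable_norm hs)
      (fun k => norm_nonneg _)
      (fun k => mul_nonneg (bracket_pos k).le (norm_nonneg _))
      (fun k => norm_nonneg _)).1).mul_left 2) fun p => ?_
    simp only [hT₁, norm_mul, Complex.norm_real, RCLike.norm_conj, Real.norm_eq_abs]
    calc ‖d p.1‖ * (|kernel ν p.1 p.2| * ‖a p.2‖ * ‖d (p.1 - p.2)‖)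
        ≤ ‖d p.1‖ * (2 * bracket (p.1 - p.2) * ‖a p.2‖ * ‖d (p.1 - p.2)‖) := by
          gcongr
          exact abs_kernel_le_bracket_sub hν _ _
      _ = _ := by ring
  have y := young' hd2 hg2 hW (fun k => norm_nonneg _)
    (fun k => by
      have := bracket_pos k
      simp only [hg, Pi.zero_apply]; positivity)
    (fun k => mul_nonneg (bracket_pos k).le (norm_nonneg _))
  have hb := y.1.mul_left 2
  have hT₂le : ∀ p, ‖T₂ p‖ ≤ 2 *
      (‖d p.1‖ * g p.2 * (bracket (p.1 - p.2) * ‖e (p.1 - p.2)‖)) := fun p => by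
    have h1 : ‖(kernel ν p.1 p.2 : ℂ) * a p.2 - (kernel 0 p.1 p.2 : ℂ) * e p.2‖ ≤
        2 * bracket (p.1 - p.2) * g p.2 := by
      have e1 : (kernel ν p.1 p.2 : ℂ) * a p.2 - (kernel 0 p.1 p.2 : ℂ) * e p.2 =
          (kernel ν p.1 p.2 : ℂ) * d p.2 +
            ((kernel ν p.1 p.2 - kernel 0 p.1 p.2 : ℝ) : ℂ) * e p.2 := by
        simp only [hd, Pi.sub_apply]; push_cast; ring
      rw [e1]
      refine (norm_add_le _ _).trans ?_
      rw [norm_mul, norm_mul, Complex.norm_real, Complex.norm_real, Real.norm_eq_abs,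
        Real.norm_eq_abs]
      calc _ ≤ 2 * bracket (p.1 - p.2) * ‖d p.2‖ +
            2 * bracket (p.1 - p.2) * (ν * bracket p.2 ^ 2) * ‖e p.2‖ := by
            gcongr
            · exact abs_kernel_le_bracket_sub hν _ _
            · exact abs_kernel_sub_kernel_zero_le hν _ _
        _ = _ := by simp only [hg]; ring
    simp only [hT₂, norm_mul, RCLike.norm_conj]
    calc _ ≤ ‖d p.1‖ * (2 * bracket (p.1 - p.2) * g p.2 * ‖e (p.1 - p.2)‖) := by gcongr
      _ = _ := by ring
  have hT₂s : Summable T₂ := Summable.of_norm_bounded hb hT₂le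
  have hT₂n : ‖∑' p, T₂ p‖ ≤
      wienerNorm e * (3 * ∑' k, ‖d k‖ ^ 2 + 2 * ν ^ 2 * sobolevSq s e) := by
    refine (tsum_of_norm_bounded hb.hasSum hT₂le).trans ?_
    rw [tsum_mul_left]
    have hw := wienerNorm_nonneg e
    calc _ ≤ 2 * (wienerNorm e * (((∑' k, ‖d k‖ ^ 2) + ∑' k, g k ^ 2) / 2)) := by
          gcongr; exact y.2
      _ = wienerNorm e * ((∑' k, ‖d k‖ ^ 2) + ∑' k, g k ^ 2) := by ring
      _ ≤ wienerNorm e * ((∑' k, ‖d k‖ ^ 2) +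
            (2 * ∑' k, ‖d k‖ ^ 2 + 2 * ν ^ 2 * sobolevSq s e)) := by gcongr
      _ = _ := by ring
  have him : (∑' p, (T₁ p + T₂ p)).im = (∑' p, T₂ p).im := by
    rw [hT₁s.tsum_add hT₂s, Complex.add_im, im_tsum_transport_eq_zero ν hreal d, zero_add]
  have hL : ∑' k, (conj (d k) * (nonlinearity ν a k - nonlinearity 0 e k)).re =
      (∑' p, (T₁ p + T₂ p)).im := by
    have hTs := hT₁s.add hT₂s
    rw [hTs.tsum_prod, Complex.im_tsum hTs.prod]
    refine tsum_congr fun k => ?_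
    have hka := summable_kernel_mul hν (ha.summable_norm hs) (ha.summable_norm hs) k
    have hke := summable_kernel_mul le_rfl (he.summable_norm hs) (he.summable_norm hs) k
    rw [nonlinearity, nonlinearity, ← mul_sub, re_conj_mul_neg_I_mul, ← hka.tsum_sub hke,
      ← tsum_mul_left]
    congr 1
    refine tsum_congr fun l => ?_
    simp only [hT₁, hT₂, hd, Pi.sub_apply]
    ring
  rw [hL, him]
  exact (le_abs_self _).trans ((Complex.abs_im_le_norm _).trans hT₂n)
/-! ### Evolution of weighted energies -/

/-- Gronwall's inequality for a weighted `ℓ²` energy of a family of curves. -/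
lemma weighted_energy_gronwall {T s α β A C W : ℝ} (hs : 2 < s) (hα : 0 < α)
    {b b' : ℝ → (Fin 2 → ℤ) → ℂ} {w : (Fin 2 → ℤ) → ℝ} (hw0 : ∀ k, 0 ≤ w k) (hwW : ∀ k, w k ≤ W)
    (hcont : ∀ k, ContinuousOn (fun t => b t k) (Icc 0 T))
    (hder : ∀ t ∈ Ioo 0 T, ∀ k, HasDerivAt (fun τ => b τ k) (b' t k) t)
    (hb : ∀ t ∈ Icc 0 T, ∀ k, ‖b t k‖ ≤ A * bracket k ^ (-s))
    (hb' : ∀ t ∈ Ioo 0 T, ∀ k, ‖b' t k‖ ≤ C * bracket k ^ (1 - s))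
    (hineq : ∀ t ∈ Ioo 0 T, ∑' k, w k * (conj (b t k) * b' t k).re ≤
      α * (∑' k, w k * ‖b t k‖ ^ 2) + β) {t : ℝ} (ht : t ∈ Icc 0 T) :
    (∑' k, w k * ‖b t k‖ ^ 2) + β / α ≤
      ((∑' k, w k * ‖b 0 k‖ ^ 2) + β / α) * Real.exp (2 * α * t) := by
  have hW : 0 ≤ W := (hw0 0).trans (hwW 0)
  have hu : Summable fun k : Fin 2 → ℤ => W * A ^ 2 * bracket k ^ (-(2 * s)) :=
    (summable_bracket_rpow (by linarith)).mul_left _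
  have hv : Summable fun k : Fin 2 → ℤ => 2 * W * A * C * bracket k ^ (-(2 * s - 1)) :=
    (summable_bracket_rpow (by linarith)).mul_left _
  have hE : ∀ t ∈ Icc 0 T, ∀ k, ‖w k * ‖b t k‖ ^ 2‖ ≤ W * A ^ 2 * bracket k ^ (-(2 * s)) :=
    fun t ht k => by
    rw [Real.norm_of_nonneg (mul_nonneg (hw0 k) (sq_nonneg _))]
    have e : bracket k ^ (-(2 * s)) = (bracket k ^ (-s)) ^ 2 := by
      rw [← Real.rpow_natCast, ← Real.rpow_mul (bracket_pos k).le]; congr 1; push_cast; ring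
    rw [e, mul_assoc, ← mul_pow]
    exact mul_le_mul (hwW k) (pow_le_pow_left₀ (norm_nonneg _) (hb t ht k) 2) (sq_nonneg _) hW
  have hE' : ∀ t ∈ Ioo 0 T, ∀ k, ‖w k * (2 * inner ℝ (b t k) (b' t k))‖ ≤
      2 * W * A * C * bracket k ^ (-(2 * s - 1)) := fun t ht k => by
    have hk := bracket_pos k
    rw [norm_mul, norm_mul, Real.norm_of_nonneg (hw0 k), Real.norm_of_nonneg two_pos.le]
    have e : bracket k ^ (-(2 * s - 1)) = bracket k ^ (-s) * bracket k ^ (1 - s) := by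
      rw [← Real.rpow_add hk]; congr 1; ring
    rw [e]
    have h1 := hb t (Ioo_subset_Icc_self ht) k
    have h2 := hb' t ht k
    calc w k * (2 * ‖inner ℝ (b t k) (b' t k)‖) ≤ W * (2 * (‖b t k‖ * ‖b' t k‖)) := by
          gcongr
          · exact hwW k
          · exact norm_inner_le_norm _ _
      _ ≤ W * (2 * ((A * bracket k ^ (-s)) * (C * bracket k ^ (1 - s)))) := by
          gcongr
          exact (norm_nonneg _).trans h1
      _ = _ := by ring
  have hEcont : ContinuousOn (fun t => ∑' k, w k * ‖b t k‖ ^ 2) (Icc 0 T) :=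
    continuousOn_tsum (fun k => continuousOn_const.mul ((hcont k).norm.pow 2)) hu
      fun k t ht => hE t ht k
  have hEder : ∀ t ∈ Ioo 0 T, HasDerivAt (fun t => ∑' k, w k * ‖b t k‖ ^ 2)
      (2 * ∑' k, w k * (conj (b t k) * b' t k).re) t := fun t ht => by
    have h := hasDerivAt_tsum_of_isPreconnected hv isOpen_Ioo isPreconnected_Ioo
      (g := fun k t => w k * ‖b t k‖ ^ 2) (g' := fun k t => w k * (2 * inner ℝ (b t k) (b' t k)))
      (fun k t ht => ((hder t ht k).norm_sq).const_mul (w k)) (fun k t ht => hE' t ht k) ht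
      (hu.of_norm_bounded fun k => hE t (Ioo_subset_Icc_self ht) k) ht
    refine h.congr_deriv ?_
    rw [← tsum_mul_left]
    refine tsum_congr fun k => ?_
    rw [Complex.inner, mul_comm (b' t k)]
    ring
  -- Adding `β / α` absorbs the inhomogeneous term, so multiplication by the integrating factor
  -- gives a nonincreasing function.
  set G : ℝ → ℝ := fun t => ((∑' k, w k * ‖b t k‖ ^ 2) + β / α) * Real.exp (-(2 * α * t)) with hG
  have hGder : ∀ t ∈ Ioo 0 T, HasDerivAt G
      ((2 * ∑' k, w k * (conj (b t k) * b' t k).re) * Real.exp (-(2 * α * t)) +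
      ((∑' k, w k * ‖b t k‖ ^ 2) + β / α) * (Real.exp (-(2 * α * t)) * (-(2 * α)))) t :=
    fun t ht => by
    refine ((hEder t ht).add_const _).mul (HasDerivAt.exp ?_)
    simpa using ((hasDerivAt_id t).const_mul (2 * α)).fun_neg
  have hanti : AntitoneOn G (Icc 0 T) := by
    refine antitoneOn_of_deriv_nonpos (convex_Icc 0 T) ?_ ?_ ?_
    · exact (hEcont.add continuousOn_const).mul (by fun_prop)
    · rw [interior_Icc]
      exact fun t ht => (hGder t ht).differentiableAt.differentiableWithinAt
    · rw [interior_Icc]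
      intro t ht
      rw [(hGder t ht).deriv]
      have h := hineq t ht
      have hexp := Real.exp_pos (-(2 * α * t))
      have hβ : α * (β / α) = β := mul_div_cancel₀ _ hα.ne'
      have : (2 * ∑' k, w k * (conj (b t k) * b' t k).re) -
          2 * α * ((∑' k, w k * ‖b t k‖ ^ 2) + β / α) ≤ 0 := by
        linear_combination 2 * h - 2 * hβ
      nlinarith
  have h := hanti ⟨le_rfl, ht.1.trans ht.2⟩ ht ht.1
  simp only [hG, mul_zero, neg_zero, Real.exp_zero, mul_one] at h
  calc _ = ((∑' k, w k * ‖b t k‖ ^ 2) + β / α) * Real.exp (-(2 * α * t)) *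
        Real.exp (2 * α * t) := by
        rw [mul_assoc, ← Real.exp_add, neg_add_cancel, Real.exp_zero, mul_one]
    _ ≤ _ := by gcongr

/-! ### Energy bounds along solutions of the Fourier system -/

/-- An `H^s` solution of the transport equation, in terms of its Fourier coefficients. -/
structure FourierSolution (ν s T : ℝ) (a : ℝ → (Fin 2 → ℤ) → ℂ) : Prop where
  real : ∀ t ∈ Icc 0 T, ∀ k, a t (-k) = conj (a t k)
  continuousOn : ∀ k, ContinuousOn (fun t => a t k) (Icc 0 T)
  bounded : ∃ K, ∀ t ∈ Icc 0 T, SobolevSeq s (a t) ∧ sobolevSq s (a t) ≤ K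
  hasDerivAt : ∀ t ∈ Ioo 0 T, ∀ k, HasDerivAt (fun τ => a τ k) (nonlinearity ν (a t) k) t

namespace FourierSolution

variable {ν s T : ℝ} {a e : ℝ → (Fin 2 → ℤ) → ℂ}

lemma mono (h : FourierSolution ν s T a) {T' : ℝ} (hT : T' ≤ T) : FourierSolution ν s T' a where
  real t ht := h.real t ⟨ht.1, ht.2.trans hT⟩
  continuousOn k := (h.continuousOn k).mono (Icc_subset_Icc_right hT)
  bounded := h.bounded.imp fun _ hK t ht => hK t ⟨ht.1, ht.2.trans hT⟩
  hasDerivAt t ht := h.hasDerivAt t ⟨ht.1, ht.2.trans_le hT⟩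

lemma sobolevSeq (h : FourierSolution ν s T a) {t : ℝ} (ht : t ∈ Icc 0 T) : SobolevSeq s (a t) :=
  (h.bounded.choose_spec t ht).1

lemma exists_decay (h : FourierSolution ν s T a) (hν : 0 ≤ ν) (hs : 2 < s) :
    ∃ A C : ℝ, (∀ t ∈ Icc 0 T, ∀ k, ‖a t k‖ ≤ A * bracket k ^ (-s)) ∧
      ∀ t ∈ Icc 0 T, ∀ k, ‖nonlinearity ν (a t) k‖ ≤ C * bracket k ^ (1 - s) := by
  obtain ⟨K, hK⟩ := h.bounded
  have key := fun t ht => norm_le_of_sobolevSq_le (hK t ht).1 (hK t ht).2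
  exact ⟨√K, _, key, fun t ht k => norm_nonlinearity_le hν hs (Real.sqrt_nonneg K) (key t ht) k⟩

/-- The `H^s` norm of a solution grows at most exponentially in its Wiener norm. -/
lemma sobolevSq_le (h : FourierSolution ν s T a) (hν : 0 ≤ ν) (hs : 2 < s) {M : ℝ} (hM : 0 < M)
    (hW : ∀ t ∈ Ioo 0 T, wienerNorm (a t) ≤ M) {t : ℝ} (ht : t ∈ Icc 0 T) :
    sobolevSq s (a t) ≤ sobolevSq s (a 0) * Real.exp (8 * commConst s * M * T) := by
  have hs0 : 0 ≤ s := by linarith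
  have hc : 0 < commConst s := by unfold commConst; positivity
  obtain ⟨A, C, hA, hC⟩ := h.exists_decay hν hs
  have h0 : (0 : ℝ) ∈ Icc 0 T := ⟨le_rfl, ht.1.trans ht.2⟩
  have key : ∀ N : ℝ, 0 < N → ∑' k, truncWeight s N k ^ 2 * ‖a t k‖ ^ 2 ≤
      sobolevSq s (a 0) * Real.exp (8 * commConst s * M * T) := fun N hN => by
    have hle : ∀ k, truncWeight s N k ^ 2 * ‖a 0 k‖ ^ 2 ≤ (bracket k ^ s * ‖a 0 k‖) ^ 2 :=
      fun k => by
      rw [← mul_pow]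
      have := truncWeight_nonneg (s := s) hN k
      gcongr
      exact truncWeight_le_bracket hs0 hN k
    have hg := weighted_energy_gronwall (α := 4 * commConst s * M) (β := 0) (W := (N ^ s) ^ 2)
      hs (by positivity) (w := fun k => truncWeight s N k ^ 2) (fun k => sq_nonneg _)
      (fun k => pow_le_pow_left₀ (truncWeight_nonneg hN k) (truncWeight_le hs0 hN k) 2)
      h.continuousOn h.hasDerivAt hA (fun t ht => hC t (Ioo_subset_Icc_self ht))
      (fun t ht => by
        have ht' := Ioo_subset_Icc_self ht
        refine (energy_le hν hs hN (h.sobolevSeq ht') (h.real t ht')).trans ?_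
        rw [add_zero]
        have : 0 ≤ ∑' k, truncWeight s N k ^ 2 * ‖a t k‖ ^ 2 :=
          tsum_nonneg fun k => mul_nonneg (sq_nonneg _) (sq_nonneg _)
        gcongr
        exact hW t ht) ht
    rw [zero_div, add_zero, add_zero] at hg
    refine hg.trans (mul_le_mul ?_ (Real.exp_le_exp.2 ?_) (Real.exp_pos _).le
      (sobolevSq_nonneg _ _))
    · refine Summable.tsum_le_tsum hle ?_ (h.sobolevSeq h0)
      exact (h.sobolevSeq h0).of_nonneg_of_le
        (fun k => mul_nonneg (sq_nonneg _) (sq_nonneg _)) hle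
    · have : 4 * commConst s * M * t ≤ 4 * commConst s * M * T := by
        gcongr
        exact ht.2
      linarith
  -- Removal of the truncation: for a finite set `F` the level `N = 1 + ∑_F ⟨k⟩` exceeds every
  -- bracket in `F`, so the truncated and full weights agree there.
  refine (h.sobolevSeq ht).tsum_le_of_sum_le fun F => ?_
  have hN : (0 : ℝ) < 1 + ∑ k ∈ F, bracket k :=
    add_pos_of_pos_of_nonneg one_pos (Finset.sum_nonneg fun k _ => (bracket_pos k).le)
  refine le_trans ?_ (key _ hN)
  have hsum : Summable fun k => truncWeight s (1 + ∑ k ∈ F, bracket k) k ^ 2 * ‖a t k‖ ^ 2 := by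
    refine (h.sobolevSeq ht).of_nonneg_of_le
      (fun k => mul_nonneg (sq_nonneg _) (sq_nonneg _)) fun k => ?_
    rw [← mul_pow]
    have := truncWeight_nonneg (s := s) hN k
    gcongr
    exact truncWeight_le_bracket hs0 hN k
  refine le_trans (le_of_eq (Finset.sum_congr rfl fun k hk => ?_))
    (hsum.sum_le_tsum F fun k _ => mul_nonneg (sq_nonneg _) (sq_nonneg _))
  have hk' := Finset.single_le_sum (f := bracket) (fun j _ => (bracket_pos j).le) hk
  rw [truncWeight, min_eq_left (by linarith), mul_pow]

/-- The `ℓ²` distance to the solution with `ν = 0` is of order `ν`. -/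
lemma tsum_sub_sq_le (h : FourierSolution ν s T a) (h₀ : FourierSolution 0 s T e) (hν : 0 ≤ ν)
    (hs : 2 < s) (hinit : a 0 = e 0) {M K : ℝ} (hM : 0 < M)
    (hW : ∀ t ∈ Icc 0 T, wienerNorm (e t) ≤ M) (hK : ∀ t ∈ Icc 0 T, sobolevSq s (e t) ≤ K)
    {t : ℝ} (ht : t ∈ Icc 0 T) :
    ∑' k, ‖(a t - e t) k‖ ^ 2 ≤ ν ^ 2 * (K * Real.exp (6 * M * T)) := by
  obtain ⟨A, C, hA, hC⟩ := h.exists_decay hν hs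
  obtain ⟨A₀, C₀, hA₀, hC₀⟩ := h₀.exists_decay le_rfl hs
  have h0 : (0 : ℝ) ∈ Icc 0 T := ⟨le_rfl, ht.1.trans ht.2⟩
  have hK0 : 0 ≤ K := (sobolevSq_nonneg _ _).trans (hK 0 h0)
  have hg := weighted_energy_gronwall (α := 3 * M) (β := 2 * M * ν ^ 2 * K) (W := 1)
      (A := A + A₀) (C := C + C₀) hs (by positivity) (w := fun k => 1)
      (b := fun t => a t - e t) (b' := fun t k => nonlinearity ν (a t) k - nonlinearity 0 (e t) k)
      (fun k => zero_le_one) (fun k => le_rfl)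
      (fun k => (h.continuousOn k).sub (h₀.continuousOn k))
      (fun t ht k => (h.hasDerivAt t ht k).sub (h₀.hasDerivAt t ht k))
      (fun t ht k => (norm_sub_le _ _).trans (by
        rw [add_mul]; exact add_le_add (hA t ht k) (hA₀ t ht k)))
      (fun t ht k => (norm_sub_le _ _).trans (by
        have ht' := Ioo_subset_Icc_self ht
        rw [add_mul]; exact add_le_add (hC t ht' k) (hC₀ t ht' k)))
      (fun t ht => by
        have ht' := Ioo_subset_Icc_self ht
        simp only [one_mul]
        refine (energy_sub_le hν hs (h.sobolevSeq ht') (h₀.sobolevSeq ht') (h.real t ht')).trans ?_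
        have e1 : 0 ≤ ∑' k, ‖(a t - e t) k‖ ^ 2 := tsum_nonneg fun k => sq_nonneg _
        have e2 := sobolevSq_nonneg s (e t)
        calc _ ≤ M * (3 * ∑' k, ‖(a t - e t) k‖ ^ 2 + 2 * ν ^ 2 * K) := by
              gcongr
              · exact hW t ht'
              · exact hK t ht'
          _ = _ := by ring) ht
  have e3 : ∑' k : Fin 2 → ℤ, (1 : ℝ) * ‖(a 0 - e 0) k‖ ^ 2 = 0 := by simp [hinit]
  have hβ : 2 * M * ν ^ 2 * K / (3 * M) = 2 / 3 * (ν ^ 2 * K) := by field_simp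
  rw [e3, hβ, zero_add] at hg
  simp only [one_mul] at hg
  have hexp : Real.exp (2 * (3 * M) * t) ≤ Real.exp (6 * M * T) := by
    apply Real.exp_le_exp.2
    have : M * t ≤ M * T := by gcongr; exact ht.2
    linarith
  have h5 : 0 ≤ ν ^ 2 * K := by positivity
  calc _ ≤ 2 / 3 * (ν ^ 2 * K) * Real.exp (2 * (3 * M) * t) := by linarith
    _ ≤ 1 * (ν ^ 2 * K) * Real.exp (6 * M * T) := by gcongr; norm_num
    _ = _ := by ring

/-! ### Continuity of the Wiener norm and the bootstrap -/

lemma wienerNorm_le_add {b c : (Fin 2 → ℤ) → ℂ} (hs : 2 < s) (hb : SobolevSeq s b)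
    (hc : SobolevSeq s c) : wienerNorm b ≤ wienerNorm c + wienerNorm (b - c) := by
  have h1 := hc.summable_wiener hs
  have h2 := (hb.sub hc).summable_wiener hs
  unfold wienerNorm
  rw [← h1.tsum_add h2]
  refine (hb.summable_wiener hs).tsum_le_tsum (fun k => ?_) (h1.add h2)
  rw [← mul_add]
  have := bracket_pos k
  gcongr
  simpa using norm_add_le (c k) ((b - c) k)

/-- Each coefficient is continuous in time, and the `H^s` bound makes the tails of differences
uniformly small. -/
lemma continuousOn_wienerNorm (h : FourierSolution ν s T a) (hs : 2 < s) :
    ContinuousOn (fun t => wienerNorm (a t)) (Icc 0 T) := by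
  obtain ⟨K, hK⟩ := h.bounded
  intro t ht
  rw [ContinuousWithinAt, Metric.tendsto_nhds]
  intro ε hε
  obtain ⟨F, hF⟩ := exists_finset_wienerNorm_le hs (4 * K) (half_pos hε)
  have hlim : Tendsto (fun τ => ∑ k ∈ F, bracket k * ‖(a τ - a t) k‖) (𝓝[Icc 0 T] t) (𝓝 0) := by
    have : Tendsto (fun τ => ∑ k ∈ F, bracket k * ‖(a τ - a t) k‖) (𝓝[Icc 0 T] t)
        (𝓝 (∑ k ∈ F, bracket k * ‖(a t - a t) k‖)) :=
      tendsto_finsetSum _ fun k _ =>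
        (((h.continuousOn k t ht).sub tendsto_const_nhds).norm.const_mul _)
    simpa using this
  filter_upwards [hlim.eventually (gt_mem_nhds (half_pos hε)), self_mem_nhdsWithin] with τ h1 hτ
  have hsub : ∀ t₁ ∈ Icc 0 T, ∀ t₂ ∈ Icc 0 T, sobolevSq s (a t₁ - a t₂) ≤ 4 * K :=
    fun t₁ h₁ t₂ h₂ => ((h.sobolevSeq h₁).sobolevSq_sub_le (h.sobolevSeq h₂)).trans (by
      linarith [(hK t₁ h₁).2, (hK t₂ h₂).2])
  have e1 := wienerNorm_le_add hs (h.sobolevSeq hτ) (h.sobolevSeq ht)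
  have e2 := wienerNorm_le_add hs (h.sobolevSeq ht) (h.sobolevSeq hτ)
  have e3 : wienerNorm (a t - a τ) = wienerNorm (a τ - a t) := by
    simp only [wienerNorm, Pi.sub_apply, norm_sub_rev]
  have e4 := hF _ ((h.sobolevSeq hτ).sub (h.sobolevSeq ht)) (hsub τ hτ t ht)
  rw [Real.dist_eq, abs_lt]
  constructor <;> linarith

/-- Uniform bounds and convergence of solutions as `ν → 0`. -/
theorem exists_uniform_bound (hs : 2 < s) (h₀ : FourierSolution 0 s T e) :
    ∃ ν₀ > 0, ∃ R C : ℝ, ∀ ν, 0 < ν → ν < ν₀ → ∀ a, FourierSolution ν s T a → a 0 = e 0 →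
      ∀ t ∈ Icc 0 T, sobolevSq s (a t - e t) ≤ R ∧ ∑' k, ‖(a t - e t) k‖ ^ 2 ≤ ν ^ 2 * C := by
  rcases lt_or_ge T 0 with hT | hT
  · exact ⟨1, one_pos, 0, 0, fun ν _ _ a _ _ t ht => absurd (ht.1.trans ht.2) (not_le.2 hT)⟩
  have h0 : (0 : ℝ) ∈ Icc 0 T := ⟨le_rfl, hT⟩
  obtain ⟨K, hK⟩ := h₀.bounded
  have hK0 : 0 ≤ K := (sobolevSq_nonneg _ _).trans (hK 0 h0).2
  obtain ⟨M', hM'⟩ := isCompact_Icc.bddAbove_image (h₀.continuousOn_wienerNorm hs)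
  set M := |M'| + 1 with hMdef
  have hM : 0 < M := by positivity
  have hWM : ∀ t ∈ Icc 0 T, wienerNorm (e t) ≤ M := fun t ht =>
    (hM' (mem_image_of_mem _ ht)).trans (by linarith [le_abs_self M'])
  set R := K * Real.exp (8 * commConst s * (M + 1) * T) with hR
  set C := K * Real.exp (6 * M * T) with hC
  have hC0 : 0 ≤ C := by positivity
  -- `F` depends only on the bound for the difference in `H^s`, hence not on `ν`. The tail
  -- contributes `1/4`, and the threshold on `ν` below makes the part over `F` at most `1/4`, for a
  -- total of `1/2`.
  obtain ⟨F, hF⟩ := exists_finset_wienerNorm_le hs (2 * R + 2 * K) (show (0 : ℝ) < 1 / 4 by norm_num)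
  have hS0 : 0 ≤ ∑ k ∈ F, bracket k := Finset.sum_nonneg fun k _ => (bracket_pos k).le
  have hS1 : 0 < 4 * ((∑ k ∈ F, bracket k) * √C + 1) := by positivity
  refine ⟨1 / (4 * ((∑ k ∈ F, bracket k) * √C + 1)), by positivity, 2 * R + 2 * K, C, ?_⟩
  intro ν hν hνlt a h hinit
  have hbootstrap : ∀ t ∈ Icc 0 T, (∀ τ ∈ Ioo 0 t, wienerNorm (a τ) ≤ M + 1) →
      sobolevSq s (a t - e t) ≤ 2 * R + 2 * K ∧ wienerNorm (a t) ≤ M + 1 / 2 := by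
    intro t ht hτ
    have hcom := commConst_nonneg (s := s) (by linarith)
    have hSa : sobolevSq s (a t) ≤ R := by
      refine ((h.mono ht.2).sobolevSq_le hν.le hs (by linarith) hτ ⟨ht.1, le_rfl⟩).trans ?_
      rw [hinit, hR]
      gcongr
      · exact (hK 0 h0).2
      · exact ht.2
    have hd := ((h.sobolevSeq ht).sobolevSq_sub_le (h₀.sobolevSeq ht)).trans
      (show _ ≤ 2 * R + 2 * K by linarith [(hK t ht).2])
    refine ⟨hd, ?_⟩
    have hdS := (h.sobolevSeq ht).sub (h₀.sobolevSeq ht)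
    have h2 := h.tsum_sub_sq_le h₀ hν.le hs hinit hM hWM (fun t ht => (hK t ht).2) ht
    have hk : ∀ k, ‖(a t - e t) k‖ ≤ ν * √C := fun k => by
      have h3 : ‖(a t - e t) k‖ ^ 2 ≤ ν ^ 2 * C :=
        ((hdS.summable_norm_sq hs).le_tsum k fun _ _ => sq_nonneg _).trans h2
      apply le_of_sq_le_sq _ (by positivity)
      rwa [mul_pow, Real.sq_sqrt hC0]
    have h4 : ∑ k ∈ F, bracket k * ‖(a t - e t) k‖ ≤ 1 / 4 := by
      calc _ ≤ ∑ k ∈ F, bracket k * (ν * √C) :=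
            Finset.sum_le_sum fun k _ => mul_le_mul_of_nonneg_left (hk k) (bracket_pos k).le
        _ = ν * ((∑ k ∈ F, bracket k) * √C) := by rw [← Finset.sum_mul]; ring
        _ ≤ 1 / (4 * ((∑ k ∈ F, bracket k) * √C + 1)) * ((∑ k ∈ F, bracket k) * √C + 1) := by
            gcongr
            linarith
        _ = 1 / 4 := by field_simp
    have h5 := hF _ hdS hd
    have h6 := wienerNorm_le_add hs (h.sobolevSeq ht) (h₀.sobolevSeq ht)
    linarith [hWM t ht]
  have hall : ∀ t ∈ Icc 0 T, wienerNorm (a t) ≤ M + 1 := by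
    by_contra! hcon
    have hclosed : IsClosed (Icc 0 T ∩ (fun t => wienerNorm (a t)) ⁻¹' Ici (M + 1)) :=
      (h.continuousOn_wienerNorm hs).preimage_isClosed_of_isClosed isClosed_Icc isClosed_Ici
    obtain ⟨t₁, ht₁, hlt⟩ := hcon
    -- The first time at which the Wiener norm is at least `M + 1`; the bound holds strictly before
    -- it, so the bootstrap gives `M + 1/2` there.
    obtain ⟨t, ht⟩ := (isCompact_Icc.of_isClosed_subset hclosed inter_subset_left).exists_isLeast
      ⟨t₁, ht₁, hlt.le⟩
    have hlast := (hbootstrap t ht.1.1 fun τ hτ => by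
      by_contra! hc
      exact absurd (ht.2 ⟨⟨hτ.1.le, hτ.2.le.trans ht.1.1.2⟩, hc.le⟩) (not_le.2 hτ.2)).2
    have hge : M + 1 ≤ wienerNorm (a t) := ht.1.2
    linarith
  intro t ht
  exact ⟨(hbootstrap t ht fun τ hτ => hall τ ⟨hτ.1.le, hτ.2.le.trans ht.2⟩).1,
    h.tsum_sub_sq_le h₀ hν.le hs hinit hM hWM (fun t ht => (hK t ht).2) ht⟩

/-- Convergence of the Fourier coefficients in every Sobolev norm of order at most `s - 1`. -/
theorem tendsto_sobolevSq (hs : 2 < s) {r : ℝ} (hr : r + 1 ≤ s) {a : ℝ → ℝ → (Fin 2 → ℤ) → ℂ}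
    (h₀ : FourierSolution 0 s T (a 0)) (h : ∀ ν, 0 < ν → FourierSolution ν s T (a ν))
    (hinit : ∀ ν, 0 < ν → a ν 0 = a 0 0) {t : ℝ} (ht : t ∈ Icc 0 T) :
    Tendsto (fun ν => sobolevSq r (a ν t - a 0 t)) (𝓝[>] 0) (𝓝 0) := by
  obtain ⟨ν₀, hν₀, R, C, hRC⟩ := exists_uniform_bound hs h₀
  have hev : ∀ᶠ ν in 𝓝[>] (0 : ℝ), 0 < ν ∧ ν < ν₀ := Ioo_mem_nhdsGT hν₀
  have hcoef : ∀ k, Tendsto (fun ν => ‖(a ν t - a 0 t) k‖ ^ 2) (𝓝[>] 0) (𝓝 0) := fun k => by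
    have hlim : Tendsto (fun ν : ℝ => ν ^ 2 * C) (𝓝[>] 0) (𝓝 0) := by
      have : Tendsto (fun ν : ℝ => ν ^ 2 * C) (𝓝 0) (𝓝 (0 ^ 2 * C)) :=
        ((continuous_pow 2).mul continuous_const).tendsto 0
      rw [zero_pow two_ne_zero, zero_mul] at this
      exact this.mono_left nhdsWithin_le_nhds
    refine squeeze_zero' (Eventually.of_forall fun _ => sq_nonneg _) ?_ hlim
    filter_upwards [hev] with ν hν
    have hd := ((h ν hν.1).sobolevSeq ht).sub (h₀.sobolevSeq ht)
    exact ((hd.summable_norm_sq hs).le_tsum k fun _ _ => sq_nonneg _).trans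
      (hRC ν hν.1 hν.2 _ (h ν hν.1) (hinit ν hν.1) t ht).2
  rw [Metric.tendsto_nhds]
  intro ε hε
  obtain ⟨F, hF⟩ := exists_finset_sobolevSq_le hr R (half_pos hε)
  have hsum : Tendsto (fun ν => ∑ k ∈ F, (bracket k ^ r * ‖(a ν t - a 0 t) k‖) ^ 2)
      (𝓝[>] 0) (𝓝 0) := by
    have := tendsto_finsetSum F fun k _ => (hcoef k).const_mul ((bracket k ^ r) ^ 2)
    simpa [mul_pow] using this
  filter_upwards [hsum.eventually (gt_mem_nhds (half_pos hε)), hev] with ν h1 hν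
  have hd := ((h ν hν.1).sobolevSeq ht).sub (h₀.sobolevSeq ht)
  have h2 := hF _ hd (hRC ν hν.1 hν.2 _ (h ν hν.1) (hinit ν hν.1) t ht).1
  rw [Real.dist_eq, sub_zero, abs_of_nonneg (sobolevSq_nonneg _ _)]
  linarith

end FourierSolution
/-! ### Characters and Fourier coefficients -/

lemma norm_mode (k : Fin 2 → ℤ) (x : Torus) : ‖mode k x‖ = 1 := by
  rw [mode, norm_prod]
  exact Finset.prod_eq_one fun j _ => Circle.norm_coe _

lemma continuous_mode (k : Fin 2 → ℤ) : Continuous (mode k) := by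
  unfold mode
  exact continuous_finsetProd _ fun j _ => (fourier (k j)).continuous.comp (continuous_apply j)

lemma mode_add_left (k l : Fin 2 → ℤ) (x : Torus) : mode (k + l) x = mode k x * mode l x := by
  simp only [mode, Pi.add_apply, fourier_add, Finset.prod_mul_distrib]

lemma conj_mode (k : Fin 2 → ℤ) (x : Torus) : conj (mode k x) = mode (-k) x := by
  simp only [mode, Pi.neg_apply, fourier_neg, map_prod]

lemma mode_add_right (k : Fin 2 → ℤ) (x y : Torus) : mode k (x + y) = mode k x * mode k y := by
  simp only [mode, Pi.add_apply, fourier_apply, smul_add, AddCircle.toCircle_add, Circle.coe_mul,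
    Finset.prod_mul_distrib]

lemma mode_proj (k : Fin 2 → ℤ) (y : Fin 2 → ℝ) :
    mode k (proj y) = ∏ j, Complex.exp (Complex.I * k j * y j) := by
  refine Finset.prod_congr rfl fun j _ => ?_
  rw [proj, fourier_coe_apply]
  congr 1
  have : (π : ℂ) ≠ 0 := by exact_mod_cast Real.pi_ne_zero
  push_cast
  field_simp

lemma mode_proj_single (k : Fin 2 → ℤ) (j : Fin 2) (h : ℝ) :
    mode k (proj (Pi.single j h)) = Complex.exp (Complex.I * k j * h) := by
  rw [mode_proj, Fin.prod_univ_two]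
  fin_cases j <;> simp

lemma hasDerivAt_mode (k : Fin 2 → ℤ) (j : Fin 2) (x : Torus) :
    HasDerivAt (fun h : ℝ => mode k (x + proj (Pi.single j h))) (Complex.I * k j * mode k x) 0 := by
  simp_rw [mode_add_right, mode_proj_single]
  have h1 : HasDerivAt (fun h : ℝ => Complex.I * k j * (h : ℂ)) (Complex.I * k j) 0 := by
    simpa using (Complex.ofRealCLM.hasDerivAt (x := (0 : ℝ))).const_mul (Complex.I * (k j : ℂ))
  have h2 := (h1.cexp).const_mul (mode k x)
  refine h2.congr_deriv ?_
  simp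
  ring

variable {f g : Torus → ℝ}

lemma integrable_mul_mode (hf : Integrable f) (k : Fin 2 → ℤ) :
    Integrable fun x => (f x : ℂ) * mode k x :=
  hf.ofReal.mul_bdd (c := 1) (continuous_mode k).aestronglyMeasurable
    (Eventually.of_forall fun x => (norm_mode k x).le)

lemma coeff_neg (f : Torus → ℝ) (k : Fin 2 → ℤ) : coeff f (-k) = conj (coeff f k) := by
  rw [coeff, coeff, map_mul, ← Complex.ofReal_inv, Complex.conj_ofReal, ← integral_conj]
  simp only [map_mul, Complex.conj_ofReal, conj_mode]

lemma coeff_sub (hf : Integrable f) (hg : Integrable g) (k : Fin 2 → ℤ) :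
    coeff (f - g) k = coeff f k - coeff g k := by
  rw [coeff, coeff, coeff, ← mul_sub,
    ← integral_sub (integrable_mul_mode hf _) (integrable_mul_mode hg _)]
  simp only [Pi.sub_apply, Complex.ofReal_sub, sub_mul]

lemma norm_coeff_le (f : Torus → ℝ) (k : Fin 2 → ℤ) :
    ‖coeff f k‖ₑ ≤ ‖(((2 * π) ^ 2 : ℝ) : ℂ)⁻¹‖ₑ * eLpNorm f 1 volume := by
  rw [coeff, enorm_mul]
  gcongr
  refine (enorm_integral_le_lintegral_enorm _).trans (le_of_eq ?_)
  rw [eLpNorm_one_eq_lintegral_enorm]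
  refine lintegral_congr fun x => ?_
  rw [enorm_mul, ← ofReal_norm (mode _ _), norm_mode]
  simp [enorm_eq_nnnorm]

lemma integral_mul_mode (f : Torus → ℝ) (k : Fin 2 → ℤ) :
    ∫ x, (f x : ℂ) * mode (-k) x = (((2 * π) ^ 2 : ℝ) : ℂ) * coeff f k := by
  have : (((2 * π) ^ 2 : ℝ) : ℂ) ≠ 0 := by
    exact_mod_cast (pow_pos Real.two_pi_pos 2).ne'
  rw [coeff, mul_inv_cancel_left₀ this]

/-! ### Sobolev norms -/

lemma one_add_normSq_rpow_mul (s : ℝ) (k : Fin 2 → ℤ) (x : ℝ) :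
    (1 + normSq k) ^ s * x ^ 2 = (bracket k ^ s * x) ^ 2 := by
  rw [← bracket_sq, mul_pow, ← Real.rpow_natCast, ← Real.rpow_natCast (bracket k ^ s),
    ← Real.rpow_mul (bracket_pos k).le, ← Real.rpow_mul (bracket_pos k).le, mul_comm s]

lemma sobolevNorm_eq {s : ℝ} (h : SobolevSeq s (coeff f)) :
    sobolevNorm s f = ENNReal.ofReal (sobolevSq s (coeff f)) ^ (1 / 2 : ℝ) := by
  simp only [sobolevNorm, one_add_normSq_rpow_mul]
  rw [sobolevSq, ENNReal.ofReal_tsum_of_nonneg (fun _ => sq_nonneg _) h]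

lemma sobolevSeq_of_sobolevNorm_le {s : ℝ} {K : ℝ≥0} (h : sobolevNorm s f ≤ K) :
    SobolevSeq s (coeff f) ∧ sobolevSq s (coeff f) ≤ K ^ 2 := by
  have hlt : ∑' k, ENNReal.ofReal ((bracket k ^ s * ‖coeff f k‖) ^ 2) ≠ ⊤ := by
    intro htop
    simp only [sobolevNorm, one_add_normSq_rpow_mul, htop] at h
    rw [ENNReal.top_rpow_of_pos (by norm_num)] at h
    exact ENNReal.coe_ne_top (top_le_iff.1 h)
  have hs : SobolevSeq s (coeff f) := by
    have := ENNReal.summable_toReal hlt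
    simp only [ENNReal.toReal_ofReal (sq_nonneg _)] at this
    exact this
  refine ⟨hs, ?_⟩
  rw [sobolevNorm_eq hs] at h
  have h2 := ENNReal.rpow_le_rpow h (show (0 : ℝ) ≤ 2 by norm_num)
  rw [← ENNReal.rpow_mul] at h2
  norm_num at h2
  rw [← ENNReal.coe_pow, ENNReal.ofReal_le_coe] at h2
  exact_mod_cast h2

/-! ### The velocity field -/

lemma symbol_neg (ν : ℝ) (k : Fin 2 → ℤ) (j : Fin 2) : symbol ν (-k) j = symbol ν k j := by
  fin_cases j <;> simp [symbol, normSq]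

/-- The terms at `k` and `-k` are conjugate, so the real part in the definition discards nothing. -/
lemma ofReal_velocity (ν : ℝ) (f : Torus → ℝ) (x : Torus) (j : Fin 2) :
    (velocity ν f x j : ℂ) = ∑' k, (symbol ν k j : ℂ) * coeff f k * mode k x := by
  rw [velocity]
  apply Complex.conj_eq_iff_re.1
  rw [Complex.conj_tsum, ← (Equiv.neg (Fin 2 → ℤ)).tsum_eq]
  refine tsum_congr fun k => ?_
  simp [symbol_neg, coeff_neg, conj_mode]

lemma continuous_velocity {ν : ℝ} (hν : 0 ≤ ν) (hf : Summable fun k => ‖coeff f k‖) (j : Fin 2) :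
    Continuous fun x => velocity ν f x j := by
  refine Complex.continuous_re.comp (continuous_tsum
    (fun k => continuous_const.mul (continuous_mode k)) hf fun k x => ?_)
  rw [norm_mul, norm_mul, norm_mode, mul_one, Complex.norm_real]
  exact mul_le_of_le_one_left (norm_nonneg _) (abs_symbol_le hν k j)

lemma integrable_velocity_mul {ν : ℝ} (hν : 0 ≤ ν) (hf : Integrable f)
    (hc : Summable fun k => ‖coeff f k‖) (k : Fin 2 → ℤ) (j : Fin 2) :
    Integrable fun x => (velocity ν f x j : ℂ) * ((f x : ℂ) * mode (-k) x) := by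
  obtain ⟨C, hC⟩ := isCompact_univ.exists_bound_of_continuousOn
    (continuous_velocity hν hc j).continuousOn
  refine (integrable_mul_mode hf (-k)).bdd_mul (c := C)
    (Complex.continuous_ofReal.comp (continuous_velocity hν hc j)).aestronglyMeasurable
    (Eventually.of_forall fun x => ?_)
  simpa using hC x (mem_univ x)

/-- A product has convolved Fourier coefficients. Sum and integral are exchanged using absolute
summability of the coefficients and `|symbol| ≤ 1`. -/
lemma integral_velocity_mul {ν : ℝ} (hν : 0 ≤ ν) (hf : Integrable f)
    (hc : Summable fun k => ‖coeff f k‖) (k : Fin 2 → ℤ) (j : Fin 2) :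
    ∫ x, (velocity ν f x j : ℂ) * ((f x : ℂ) * mode (-k) x) =
      (((2 * π) ^ 2 : ℝ) : ℂ) * ∑' l, (symbol ν l j : ℂ) * coeff f l * coeff f (k - l) := by
  have e1 : ∀ x, (velocity ν f x j : ℂ) * ((f x : ℂ) * mode (-k) x) =
      ∑' l, (symbol ν l j : ℂ) * coeff f l * ((f x : ℂ) * mode (-(k - l)) x) := fun x => by
    rw [ofReal_velocity, ← tsum_mul_right]
    refine tsum_congr fun l => ?_
    rw [neg_sub, sub_eq_add_neg, mode_add_left]; ring
  simp_rw [e1]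
  rw [← integral_tsum_of_summable_integral_norm]
  · rw [← tsum_mul_left]
    refine tsum_congr fun l => ?_
    rw [integral_const_mul, integral_mul_mode]; ring
  · exact fun l => (integrable_mul_mode hf _).const_mul _
  · refine (hc.mul_right (∫ x, ‖f x‖)).of_nonneg_of_le
      (fun l => integral_nonneg fun x => norm_nonneg _) fun l => ?_
    simp only [norm_mul, norm_mode, mul_one, Complex.norm_real]
    rw [integral_const_mul]
    gcongr
    exact mul_le_of_le_one_left (norm_nonneg _) (abs_symbol_le hν l j)

lemma nonlinearity_eq {ν : ℝ} (hν : 0 ≤ ν) (hc : Summable fun k => ‖coeff f k‖) (k : Fin 2 → ℤ) :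
    nonlinearity ν (coeff f) k =
      ∑ j, -Complex.I * k j * ∑' l, (symbol ν l j : ℂ) * coeff f l * coeff f (k - l) := by
  have hs : ∀ j, Summable fun l => (symbol ν l j : ℂ) * coeff f l * coeff f (k - l) := fun j => by
    refine Summable.of_norm_bounded (hc.mul_right (∑' i, ‖coeff f i‖)) fun l => ?_
    rw [norm_mul, norm_mul, Complex.norm_real]
    gcongr
    · exact mul_le_of_le_one_left (norm_nonneg _) (abs_symbol_le hν l j)
    · exact hc.le_tsum _ fun _ _ => norm_nonneg _
  rw [nonlinearity, Fin.sum_univ_two, mul_assoc, mul_assoc, ← mul_add]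
  congr 1
  rw [← tsum_mul_left (a := (k 0 : ℂ)), ← tsum_mul_left (a := (k 1 : ℂ)),
    ← ((hs 0).mul_left _).tsum_add ((hs 1).mul_left _)]
  refine tsum_congr fun l => ?_
  simp only [kernel, Fin.sum_univ_two]
  push_cast; ring

/-- The spatial part of the weak formulation, tested against a character. -/
lemma integral_weak {ν : ℝ} (hν : 0 ≤ ν) (hf : Integrable f)
    (hc : Summable fun k => ‖coeff f k‖) (k : Fin 2 → ℤ) (p q : ℝ) (c : ℂ) :
    ∫ x, (p * (c * mode (-k) x).re +
      ∑ j, velocity ν f x j * (q * (c * (Complex.I * (-k) j * mode (-k) x)).re)) * f x =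
    (c * (((2 * π) ^ 2 : ℝ) : ℂ) * (p * coeff f k + q * nonlinearity ν (coeff f) k)).re := by
  have hi := integrable_mul_mode hf (-k)
  have hv := fun j => integrable_velocity_mul hν hf hc k j
  have e1 : ∀ x, (p * (c * mode (-k) x).re +
      ∑ j, velocity ν f x j * (q * (c * (Complex.I * (-k) j * mode (-k) x)).re)) * f x =
      (c * p * ((f x : ℂ) * mode (-k) x) + ∑ j, c * q * (-Complex.I * k j) *
        ((velocity ν f x j : ℂ) * ((f x : ℂ) * mode (-k) x))).re := fun x => by
    have a1 : ((p * (c * mode (-k) x).re * f x : ℝ)) =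
        (c * p * ((f x : ℂ) * mode (-k) x)).re := by
      rw [show c * p * ((f x : ℂ) * mode (-k) x) =
        ((p * f x : ℝ) : ℂ) * (c * mode (-k) x) by push_cast; ring, Complex.re_ofReal_mul]
      ring
    have a2 : ∀ j, velocity ν f x j * (q * (c * (Complex.I * (-k) j * mode (-k) x)).re) * f x =
        (c * q * (-Complex.I * k j) *
          ((velocity ν f x j : ℂ) * ((f x : ℂ) * mode (-k) x))).re := fun j => by
      rw [show c * q * (-Complex.I * k j) * ((velocity ν f x j : ℂ) * ((f x : ℂ) * mode (-k) x)) =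
        ((velocity ν f x j * q * f x : ℝ) : ℂ) * (c * (Complex.I * (-k) j * mode (-k) x)) by
          push_cast [Pi.neg_apply]; ring, Complex.re_ofReal_mul]
      ring
    rw [add_mul, Finset.sum_mul, Complex.add_re, Complex.re_sum, a1]
    congr 1
    exact Finset.sum_congr rfl fun j _ => a2 j
  simp_rw [e1]
  have hint : Integrable fun x => c * p * ((f x : ℂ) * mode (-k) x) +
      ∑ j, c * q * (-Complex.I * k j) * ((velocity ν f x j : ℂ) * ((f x : ℂ) * mode (-k) x)) :=
    (hi.const_mul _).add (integrable_finsetSum _ fun j _ => (hv j).const_mul _)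
  have hre := integral_re hint
  simp only [RCLike.re_eq_complex_re] at hre
  rw [hre, integral_add (hi.const_mul _) (integrable_finsetSum _ fun j _ => (hv j).const_mul _),
    integral_finsetSum _ fun j _ => (hv j).const_mul _]
  simp_rw [integral_const_mul, integral_mul_mode, integral_velocity_mul hν hf hc]
  rw [nonlinearity_eq hν hc, Fin.sum_univ_two, Fin.sum_univ_two]
  congr 1
  ring
/-! ### From the weak formulation to the Fourier system -/

/-- A weak derivative in time, with continuous data, is a classical derivative. -/
lemma hasDerivAt_of_weak {T : ℝ} (hT : 0 < T) {a n : ℝ → ℂ} (ha : ContinuousOn a (Icc 0 T))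
    (hn : ContinuousOn n (Icc 0 T))
    (hweak : ∀ ψ : ℝ → ℝ, ContDiff ℝ ((⊤ : ℕ∞) : WithTop ℕ∞) ψ →
      (∃ T' < T, ∀ t, T' ≤ t → ψ t = 0) →
      (∫ t in (0 : ℝ)..T, (((deriv ψ t : ℝ) : ℂ) * a t + (ψ t : ℂ) * n t)) + (ψ 0 : ℂ) * a 0 = 0)
    {t : ℝ} (ht : t ∈ Ioo 0 T) : HasDerivAt a (n t) t := by
  set m : ℝ → ℂ := IccExtend hT.le ((Icc 0 T).domRestrict n) with hm
  have hmc : Continuous m := (continuousOn_iff_continuous_domRestrict.1 hn).Icc_extend'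
  have hmn : ∀ t ∈ Icc 0 T, m t = n t := fun t ht => IccExtend_of_mem hT.le _ ht
  -- The classical solution with the same initial value, built from a continuous extension `m` of
  -- `n`; it remains to show `a = G` inside the interval.
  set G : ℝ → ℂ := fun t => a 0 + ∫ τ in (0 : ℝ)..t, m τ with hG
  have hGd : ∀ t, HasDerivAt G (m t) t := fun t =>
    (hmc.integral_hasStrictDerivAt 0 t).hasDerivAt.const_add _
  have hGc : Continuous G := continuous_iff_continuousAt.2 fun t => (hGd t).continuousAt
  have hG0 : G 0 = a 0 := by simp [hG]
  have hIcc : uIcc 0 T = Icc 0 T := uIcc_of_le hT.le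
  have hDc : ContinuousOn (fun t => a t - G t) (Icc 0 T) := ha.sub hGc.continuousOn
  have hae : ∀ᵐ t, t ∈ Ioo 0 T → a t - G t = 0 := by
    refine isOpen_Ioo.ae_eq_zero_of_integral_contDiff_smul_eq_zero
      ((hDc.mono Ioo_subset_Icc_self).locallyIntegrableOn measurableSet_Ioo) ?_
    intro η hη hηc hηs
    -- The primitive of `η` vanishing at `T`. It vanishes near `T` but possibly not at `0`; the
    -- boundary term there cancels against `G 0 = a 0`, leaving `∫ η (a - G) = 0`.
    set ψ : ℝ → ℝ := fun t => ∫ τ in T..t, η τ with hψ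
    have hψd : ∀ t, HasDerivAt ψ (η t) t := fun t =>
      (hη.continuous.integral_hasStrictDerivAt T t).hasDerivAt
    have hψ' : deriv ψ = η := funext fun t => (hψd t).deriv
    have hψs : ContDiff ℝ ((⊤ : ℕ∞) : WithTop ℕ∞) ψ :=
      contDiff_infty_iff_deriv.2 ⟨fun t => (hψd t).differentiableAt, hψ' ▸ hη⟩
    have hψT : ψ T = 0 := intervalIntegral.integral_same
    have hvan : ∃ T' < T, ∀ t, T' ≤ t → ψ t = 0 := by
      have key : ∃ T' < T, ∀ t, T' < t → η t = 0 := by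
        rcases (tsupport η).eq_empty_or_nonempty with h | h
        · exact ⟨0, hT, fun t _ => image_eq_zero_of_notMem_tsupport (by simp [h])⟩
        · obtain ⟨T', hT'⟩ := hηc.isCompact.exists_isGreatest h
          exact ⟨T', (hηs hT'.1).2, fun t ht =>
            image_eq_zero_of_notMem_tsupport fun hmem => absurd (hT'.2 hmem) (not_le.2 ht)⟩
      obtain ⟨T', hT', hzero⟩ := key
      refine ⟨T', hT', fun t ht => ?_⟩
      rw [hψ]
      refine (intervalIntegral.integral_congr_ae (g := fun _ => 0)
        (Eventually.of_forall fun τ hτ => hzero τ ?_)).trans (by simp)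
      exact (le_min hT'.le ht).trans_lt hτ.1
    have hw := hweak ψ hψs hvan
    have hηC : Continuous fun t => (η t : ℂ) := Complex.continuous_ofReal.comp hη.continuous
    have hψC : Continuous fun t => (ψ t : ℂ) := Complex.continuous_ofReal.comp hψs.continuous
    have hparts := intervalIntegral.integral_mul_deriv_eq_deriv_mul (a := 0) (b := T)
      (u := fun t => (ψ t : ℂ)) (v := G) (u' := fun t => (η t : ℂ)) (v' := m)
      (fun t _ => (hψd t).ofReal_comp) (fun t _ => hGd t)
      (hηC.intervalIntegrable _ _) (hmc.intervalIntegrable _ _)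
    have i1 : IntervalIntegrable (fun t => (η t : ℂ) * a t) volume 0 T :=
      ContinuousOn.intervalIntegrable (hIcc ▸ hηC.continuousOn.mul ha)
    have i2 : IntervalIntegrable (fun t => (ψ t : ℂ) * m t) volume 0 T :=
      (hψC.mul hmc).intervalIntegrable _ _
    have i3 : IntervalIntegrable (fun t => (η t : ℂ) * G t) volume 0 T :=
      (hηC.mul hGc).intervalIntegrable _ _
    have hw2 : ∫ t in (0 : ℝ)..T, (((deriv ψ t : ℝ) : ℂ) * a t + (ψ t : ℂ) * n t) =
        ∫ t in (0 : ℝ)..T, ((η t : ℂ) * a t + (ψ t : ℂ) * m t) := by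
      refine intervalIntegral.integral_congr fun t ht => ?_
      simp only [hψ', hmn t (hIcc ▸ ht)]
    rw [hw2, intervalIntegral.integral_add i1 i2, hparts, hψT, hG0] at hw
    have hsupp : Function.support (fun t => η t • (a t - G t)) ⊆ Ioc 0 T := fun t ht =>
      Ioo_subset_Ioc_self (hηs (subset_tsupport _ (Function.support_smul_subset_left _ _ ht)))
    rw [← intervalIntegral.integral_eq_integral_of_support_subset hsupp]
    simp only [Complex.real_smul, mul_sub]
    rw [intervalIntegral.integral_sub i1 i3]
    simp only [Complex.ofReal_zero, zero_mul, zero_sub] at hw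
    linear_combination hw
  have heq : EqOn (fun t => a t - G t) 0 (Ioo 0 T) :=
    Measure.eqOn_open_of_ae_eq (μ := volume) ((ae_restrict_iff' measurableSet_Ioo).2 hae)
      isOpen_Ioo (hDc.mono Ioo_subset_Icc_self) continuousOn_const
  rw [← hmn t (Ioo_subset_Icc_self ht)]
  refine (hGd t).congr_of_eventuallyEq ?_
  filter_upwards [isOpen_Ioo.mem_nhds ht] with τ hτ
  exact sub_eq_zero.1 (heq hτ)

/-- For fixed `k` the series converges uniformly in time: one factor supplies the summable
`⟨l⟩^(-s)`, the other is merely bounded. -/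
lemma continuousOn_nonlinearity {ν s T A : ℝ} (hν : 0 ≤ ν) (hs : 2 < s)
    {a : ℝ → (Fin 2 → ℤ) → ℂ} (ha : ∀ k, ContinuousOn (fun t => a t k) (Icc 0 T))
    (hA : ∀ t ∈ Icc 0 T, ∀ k, ‖a t k‖ ≤ A * bracket k ^ (-s)) (k : Fin 2 → ℤ) :
    ContinuousOn (fun t => nonlinearity ν (a t) k) (Icc 0 T) := by
  refine continuousOn_const.mul (continuousOn_tsum
    (u := fun l => 2 * bracket k * A * A * bracket l ^ (-s))
    (fun l => (continuousOn_const.mul (ha l)).mul (ha (k - l)))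
    ((summable_bracket_rpow hs).mul_left _) fun l t ht => ?_)
  rw [norm_mul, norm_mul, Complex.norm_real, Real.norm_eq_abs]
  have hl := Real.rpow_pos_of_pos (bracket_pos l) (-s)
  have hA0 : 0 ≤ A := by
    by_contra! h
    exact absurd ((norm_nonneg _).trans (hA t ht l)) (not_le.2 (mul_neg_of_neg_of_pos h hl))
  have h1 : bracket (k - l) ^ (-s) ≤ 1 :=
    Real.rpow_le_one_of_one_le_of_nonpos (one_le_bracket _) (by linarith)
  have h2 : ‖a t (k - l)‖ ≤ A := (hA t ht _).trans (mul_le_of_le_one_right hA0 h1)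
  have hk := bracket_pos k
  calc |kernel ν k l| * ‖a t l‖ * ‖a t (k - l)‖
      ≤ 2 * bracket k * (A * bracket l ^ (-s)) * A := by
        gcongr
        · exact abs_kernel_le_bracket hν k l
        · exact hA t ht l
    _ = _ := by ring

lemma isTestFunction_mode {T : ℝ} {ψ : ℝ → ℝ} (hψ : ContDiff ℝ ((⊤ : ℕ∞) : WithTop ℕ∞) ψ)
    (hvan : ∃ T' < T, ∀ t, T' ≤ t → ψ t = 0) (c : ℂ) (k : Fin 2 → ℤ) :
    IsTestFunction T fun t x => ψ t * (c * mode k x).re where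
  smooth := by
    simp_rw [mode_proj]
    have h : ∀ j : Fin 2, ContDiff ℝ ((⊤ : ℕ∞) : WithTop ℕ∞)
        fun p : ℝ × (Fin 2 → ℝ) => Complex.exp (Complex.I * k j * p.2 j) := fun j =>
      (contDiff_const.mul (Complex.ofRealCLM.contDiff.comp
        ((contDiff_apply ℝ ℝ j).comp contDiff_snd))).cexp
    exact (hψ.comp contDiff_fst).mul
      (Complex.reCLM.contDiff.comp (contDiff_const.mul (contDiff_prod fun j _ => h j)))
  vanishes := by
    obtain ⟨T', hT', h⟩ := hvan
    exact ⟨T', hT', fun t ht x => by rw [h t ht, zero_mul]⟩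

lemma partialDeriv_mode (r : ℝ) (c : ℂ) (k : Fin 2 → ℤ) (j : Fin 2) (x : Torus) :
    partialDeriv j (fun x => r * (c * mode k x).re) x =
      r * (c * (Complex.I * k j * mode k x)).re := by
  have h := ((hasDerivAt_mode k j x).const_mul c)
  have h2 := (Complex.reCLM.hasFDerivAt.comp_hasDerivAt (0 : ℝ) h).const_mul r
  exact h2.deriv

/-! ### Weak solutions yield solutions of the Fourier system -/

namespace IsSolution

variable {ν s T : ℝ} {θ₀ : Torus → ℝ} {θ : ℝ → Torus → ℝ}

lemma integrable (h : IsSolution ν s T θ₀ θ) {t : ℝ} (ht : t ∈ Icc 0 T) : Integrable (θ t) :=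
  (h.memLp t ht).integrable one_le_two

/-- Coefficients are controlled by the `L¹` norm, hence by the `L²` norm since the torus has finite
measure. -/
lemma continuousOn_coeff (h : IsSolution ν s T θ₀ θ) (k : Fin 2 → ℤ) :
    ContinuousOn (fun t => coeff (θ t) k) (Icc 0 T) := by
  intro t ht
  rw [ContinuousWithinAt, tendsto_iff_edist_tendsto_0]
  have hlim : Tendsto (fun τ => ‖(((2 * π) ^ 2 : ℝ) : ℂ)⁻¹‖ₑ * (eLpNorm (θ τ - θ t) 2 volume *
      volume (univ : Set Torus) ^ (1 / (1 : ℝ≥0∞).toReal - 1 / (2 : ℝ≥0∞).toReal)))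
      (𝓝[Icc 0 T] t) (𝓝 0) := by
    have hfin : volume (univ : Set Torus) ^ (1 / (1 : ℝ≥0∞).toReal - 1 / (2 : ℝ≥0∞).toReal) ≠ ⊤ :=
      ENNReal.rpow_ne_top_of_nonneg (by norm_num) (measure_ne_top _ _)
    have := ENNReal.Tendsto.const_mul (a := ‖(((2 * π) ^ 2 : ℝ) : ℂ)⁻¹‖ₑ)
      (ENNReal.Tendsto.mul_const (h.continuous t ht) (Or.inr hfin)) (Or.inr enorm_ne_top)
    simpa only [zero_mul, mul_zero] using this
  refine tendsto_of_tendsto_of_tendsto_of_le_of_le' tendsto_const_nhds hlim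
    (Eventually.of_forall fun _ => zero_le) ?_
  filter_upwards [self_mem_nhdsWithin] with τ hτ
  rw [edist_eq_enorm_sub, ← coeff_sub (h.integrable hτ) (h.integrable ht)]
  refine (norm_coeff_le _ k).trans ?_
  gcongr
  exact eLpNorm_le_eLpNorm_mul_rpow_measure_univ one_le_two
    ((h.integrable hτ).sub (h.integrable ht)).aestronglyMeasurable

lemma coeff_zero_eq (h : IsSolution ν s T θ₀ θ) : coeff (θ 0) = coeff θ₀ := by
  funext k
  rw [coeff, coeff]
  congr 1
  refine integral_congr_ae ?_
  filter_upwards [h.initial] with x hx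
  rw [hx]

/-- The Fourier coefficients of a weak solution solve the Fourier system classically. -/
lemma fourierSolution (h : IsSolution ν s T θ₀ θ) (hν : 0 ≤ ν) (hs : 2 < s) (hT : 0 < T) :
    FourierSolution ν s T fun t => coeff (θ t) := by
  obtain ⟨K, hK⟩ := h.bounded
  have hS : ∀ t ∈ Icc 0 T, SobolevSeq s (coeff (θ t)) ∧ sobolevSq s (coeff (θ t)) ≤ K ^ 2 :=
    fun t ht => sobolevSeq_of_sobolevNorm_le (hK t ht)
  have hA := fun t ht => norm_le_of_sobolevSq_le (hS t ht).1 (hS t ht).2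
  have hnc := continuousOn_nonlinearity hν hs h.continuousOn_coeff hA
  refine ⟨fun t _ k => coeff_neg _ k, h.continuousOn_coeff, ⟨_, hS⟩, fun t ht k =>
    hasDerivAt_of_weak hT (h.continuousOn_coeff k) (hnc k) (fun ψ hψ hvan => ?_) ht⟩
  have hIcc : uIcc 0 T = Icc 0 T := uIcc_of_le hT.le
  have hψ'c : Continuous (deriv ψ) := (contDiff_infty_iff_deriv.1 hψ).2.continuous
  have hint : IntervalIntegrable (fun t => ((deriv ψ t : ℝ) : ℂ) * coeff (θ t) k +
      (ψ t : ℂ) * nonlinearity ν (coeff (θ t)) k) volume 0 T := by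
    refine ContinuousOn.intervalIntegrable (hIcc ▸ ?_)
    exact ((Complex.continuous_ofReal.comp hψ'c).continuousOn.mul (h.continuousOn_coeff k)).add
      ((Complex.continuous_ofReal.comp hψ.continuous).continuousOn.mul (hnc k))
  set X := (∫ t in (0 : ℝ)..T, (((deriv ψ t : ℝ) : ℂ) * coeff (θ t) k +
    (ψ t : ℂ) * nonlinearity ν (coeff (θ t)) k)) + (ψ 0 : ℂ) * coeff (θ 0) k with hX
  set q : ℂ := (((2 * π) ^ 2 : ℝ) : ℂ) with hq
  have hq0 : q ≠ 0 := by
    rw [hq]; exact_mod_cast (pow_pos Real.two_pi_pos 2).ne'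
  -- Test functions are real, so only real parts are accessible. Taking `c = 1` and `c = I` recovers
  -- the complex identity `q * X = 0`.
  have key : ∀ c : ℂ, (c * q * X).re = 0 := fun c => by
    have hw := h.weak _ (isTestFunction_mode hψ hvan c (-k))
    have h1 : ∫ t in (0 : ℝ)..T, ∫ x : Torus,
        (deriv (fun τ => ψ τ * (c * mode (-k) x).re) t +
          ∑ j, velocity ν (θ t) x j *
            partialDeriv j (fun x => ψ t * (c * mode (-k) x).re) x) * θ t x =
        (c * q * ∫ t in (0 : ℝ)..T, (((deriv ψ t : ℝ) : ℂ) * coeff (θ t) k +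
          (ψ t : ℂ) * nonlinearity ν (coeff (θ t)) k)).re := by
      rw [← intervalIntegral.integral_const_mul]
      have hre := Complex.reCLM.intervalIntegral_comp_comm (hint.const_mul (c * q))
      simp only [Complex.reCLM_apply] at hre
      rw [← hre]
      refine intervalIntegral.integral_congr fun t ht => ?_
      rw [hIcc] at ht
      simp only [partialDeriv_mode, deriv_mul_const_field, Pi.neg_apply]
      rw [← integral_weak hν (h.integrable ht) ((hS t ht).1.summable_norm hs)]
      simp only [Pi.neg_apply]
    have h2 : ∫ x, ψ 0 * (c * mode (-k) x).re * θ₀ x = (c * q * ((ψ 0 : ℂ) * coeff (θ 0) k)).re := by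
      have h3 : ∫ x, ψ 0 * (c * mode (-k) x).re * θ₀ x =
          ∫ x, (c * ψ 0 * ((θ 0 x : ℂ) * mode (-k) x)).re := by
        refine integral_congr_ae ?_
        filter_upwards [h.initial] with x hx
        rw [← hx, show c * ψ 0 * ((θ 0 x : ℂ) * mode (-k) x) =
          ((ψ 0 * θ 0 x : ℝ) : ℂ) * (c * mode (-k) x) by push_cast; ring, Complex.re_ofReal_mul]
        ring
      have hre := integral_re ((integrable_mul_mode (h.integrable ⟨le_rfl, hT.le⟩) (-k)).const_mul
        (c * ψ 0))
      simp only [RCLike.re_eq_complex_re] at hre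
      rw [h3, hre, integral_const_mul, integral_mul_mode]
      congr 1
      ring
    rw [h1, h2, ← Complex.add_re, ← mul_add] at hw
    exact hw
  have hre := key 1
  have him := key Complex.I
  rw [one_mul] at hre
  rw [mul_assoc, Complex.I_mul_re, neg_eq_zero] at him
  exact (mul_eq_zero.1 (Complex.ext hre him)).resolve_left hq0

end IsSolution

end IPMB

/-! ### The limit in the Sobolev norm on the torus -/

theorem theorem6p11 (s : ℝ) (hs : 2 < s) (θ₀ : IPMB.Torus → ℝ)
    (hθ₀ : IPMB.MemSobolev s θ₀) (hmean : ∫ x : IPMB.Torus, θ₀ x = 0)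
    (T : ℝ) (hT : 0 < T)
    (θ : ℝ → ℝ → IPMB.Torus → ℝ)
    (hzero : IPMB.IsSolution 0 s T θ₀ (θ 0))
    (hpos : ∀ ν : ℝ, 0 < ν → IPMB.IsSolution ν s T θ₀ (θ ν))
    (t : ℝ) (ht : t ∈ Set.Icc 0 T) :
    Filter.Tendsto (fun ν : ℝ => IPMB.sobolevNorm (s - 1) (θ ν t - θ 0 t))
      (nhdsWithin 0 (Set.Ioi 0)) (nhds 0) := by
  have h₀ := hzero.fourierSolution le_rfl hs hT
  have hν := fun ν hν => (hpos ν hν).fourierSolution hν.le hs hT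
  have hlim := IPMB.FourierSolution.tendsto_sobolevSq (r := s - 1)
    (a := fun ν t => IPMB.coeff (θ ν t)) hs (by linarith) h₀ hν
    (fun ν hν => ((hpos ν hν).coeff_zero_eq).trans hzero.coeff_zero_eq.symm) ht
  have hlim2 := (ENNReal.tendsto_ofReal hlim).ennrpow_const (1 / 2)
  rw [ENNReal.ofReal_zero, ENNReal.zero_rpow_of_pos (by norm_num)] at hlim2
  refine hlim2.congr' ?_
  filter_upwards [self_mem_nhdsWithin] with ν hpν
  have hsub : IPMB.coeff (θ ν t - θ 0 t) = IPMB.coeff (θ ν t) - IPMB.coeff (θ 0 t) :=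
    funext fun k => IPMB.coeff_sub ((hpos ν hpν).integrable ht) (hzero.integrable ht) k
  have hS := (((hν ν hpν).sobolevSeq ht).sub (h₀.sobolevSeq ht)).mono
    (show s - 1 ≤ s by linarith)
  rw [← hsub] at hS
  rw [IPMB.sobolevNorm_eq hS, hsub]
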